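/- Let $0\le k\le n$ and let $M$ be a matroid of rank $k$ on the ground set $[n]=\{1,\dots,n\}$. For $B\subseteq[n]$ let $e_B=\sum_{i\in B}e_i\in\mathbb{R}^n$, and let $\Gamma_M=\operatorname{conv}\{e_B : B \text{ a basis of } M\}\subset\mathbb{R}^n$ be the matroid polytope of $M$. A matroid on $[n]$ is a positroid if, for some $r$ and some real $r\times n$ matrix $A$ of rank $r$ all of whose maximal minors (columns taken in increasing order) are nonnegative, its bases are exactly the $r$-element sets $I\subseteq[n]$ for which the minor of $A$ on the columns $I$ is nonzero. A positroid polytope is a set of the form $\Gamma_N$ with $N$ a positroid on $[n]$. Faces of a polytope are the sets of maximizers of linear functionals on it, so the polytope is a face of itself. Then $\Gamma_M$ is a positroid polytope if and only if $M$ is a positroid, and $\Gamma_M$ is a positroid polytope if and only if all two-dimensional faces of $\Gamma_M$ are positroid polytopes. Moreover, if $M$ is not a positroid, then $\Gamma_M$ has a two-dimensional face whose vertices are exactly $e_{S\cup\{a,b\}}$, $e_{S\cup\{a,d\}}$, $e_{S\cup\{b,c\}}$, $e_{S\cup\{c,d\}}$ for some $1\le a<b<c<d\le n$ and some $S\subseteq[n]$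 with $|S|=k-2$ and $S\cap\{a,b,c,d\}=\emptyset$. -/

import Mathlib

namespace PositroidChar

/-- The indicator vector `e_B = ∑_{i ∈ B} e_i` in `ℝⁿ`. -/
noncomputable def indVec {n : ℕ} (B : Set (Fin n)) : Fin n → ℝ :=
  B.indicator 1

/-- The (basis) matroid polytope `Γ_M`: the convex hull of the indicator vectors of the bases. -/
def matroidPolytope {n : ℕ} (M : Matroid (Fin n)) : Set (Fin n → ℝ) :=
  convexHull ℝ (indVec '' {B | M.IsBase B})

/-- The Plücker coordinate `p_I(A)`: the `k × k` minor of the `k × n` matrix `A` on the columns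
in `I`, taken in increasing order. -/
noncomputable def plucker {n k : ℕ} (A : Matrix (Fin k) (Fin n) ℝ) (I : Finset (Fin n))
    (hI : I.card = k) : ℝ :=
  (A.submatrix id (I.orderEmbOfFin hI)).det

/-- `M` is a positroid on `[n]`: its bases are the `k`-subsets `I` with `p_I(A) ≠ 0`, for some
real `k × n` matrix `A` all of whose maximal minors are nonnegative. (As a matroid has a basis,
some maximal minor of `A` is nonzero, so `A` has rank `k`.) -/
def IsPositroid {n : ℕ} (M : Matroid (Fin n)) : Prop :=
  M.E = Set.univ ∧
  ∃ (k : ℕ) (A : Matrix (Fin k) (Fin n) ℝ),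
    (∀ (I : Finset (Fin n)) (hI : I.card = k), 0 ≤ plucker A I hI) ∧
    ∀ I : Finset (Fin n), M.IsBase (I : Set (Fin n)) ↔ ∃ hI : I.card = k, plucker A I hI ≠ 0

/-- A subset of `ℝⁿ` is a positroid polytope if it is the matroid polytope of a positroid. -/
def IsPositroidPolytope {n : ℕ} (P : Set (Fin n → ℝ)) : Prop :=
  ∃ N : Matroid (Fin n), IsPositroid N ∧ P = matroidPolytope N

/-- `F` is a two-dimensional face of the polytope `P`: it is the set of maximizers on `P` of some
linear functional (possibly zero, so that `P` is a face of itself), and its affine span has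
dimension two. -/
def IsTwoFace {n : ℕ} (P F : Set (Fin n → ℝ)) : Prop :=
  F.Nonempty ∧ IsExposed ℝ P F ∧ Module.finrank ℝ (vectorSpan ℝ F) = 2

end PositroidChar

/-!
Say that `M` satisfies the positive three-term condition if, for `a < b < c < d` outside `S`, two
opposite sides of the square `S + {ab, bc, cd, da}` being bases forces both diagonals `S + ac` and
`S + bd` to be bases. This condition characterizes positroids. A positroid satisfies it because of
the three-term Plücker relation, all of whose terms are nonnegative. Conversely, the condition makes
the bases exactly the sets obeying the rank inequalities of cyclic intervals, so that the set of
bases is closed under sorting; the distance `w` to the set of bases, measured by counting functions,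
then satisfies the min-plus three-term Plücker relation. Any such `w` is the vanishing order, as
`t → 0⁺`, of the positive maximal minors of a family of matrices, built one column at a time. After
a base block is normalized to the identity the matrices stay bounded, and a limit point as `t → 0⁺`
represents `M`.

The faces of the matroid polytope are the polytopes of the matroids formed by the bases that
maximize a linear functional, and these inherit the condition. Where the condition fails, all four
sides of the square are bases by basis exchange, and a functional that weighs the elements of a
missing diagonal most cuts them out as the vertices of a face; having no diagonal among its
vertices, this face is not a positroid polytope.
-/

namespace PositroidChar

open Finset Filter Topology Asymptotics

/-! ### Minors and the three-term Plücker relation -/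

section Minors

variable {n k m : ℕ}

/-- The determinant of the columns `g 0, g 1, …` of `A`, in this order: a Plücker coordinate
without the requirement that the columns be increasing. -/
noncomputable def colDet (A : Matrix (Fin k) (Fin n) ℝ) (g : Fin k → Fin n) : ℝ :=
  (A.submatrix id g).det

/-- The maximal minor of `A` on the set of columns `I`: the Plücker coordinate, extended by zero
to the sets of the wrong cardinality. -/
noncomputable def minor (A : Matrix (Fin k) (Fin n) ℝ) (I : Finset (Fin n)) : ℝ :=
  if h : I.card = k then plucker A I h else 0

theorem minor_eq (A : Matrix (Fin k) (Fin n) ℝ) {I : Finset (Fin n)} (h : I.card = k) :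
    minor A I = colDet A (I.orderEmbOfFin h) :=
  dif_pos h

theorem colDet_eq_zero (A : Matrix (Fin k) (Fin n) ℝ) {g : Fin k → Fin n}
    (hg : ¬ Function.Injective g) : colDet A g = 0 := by
  obtain ⟨i, j, hij, hne⟩ := Function.not_injective_iff.mp hg
  exact Matrix.det_zero_of_column_eq hne fun r => by simp [hij]

theorem exists_sign_colDet {g : Fin k → Fin n} (hg : Function.Injective g) :
    ∃ ε : ℤˣ, ∀ A : Matrix (Fin k) (Fin n) ℝ, colDet A g = (ε : ℤ) * minor A (univ.image g) := by
  have hcard : (univ.image g).card = k := by simp [card_image_of_injective _ hg]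
  let f : Fin k → Fin k := fun i =>
    ((univ.image g).orderIsoOfFin hcard).symm ⟨g i, mem_image_of_mem g (mem_univ i)⟩
  have hf (i : Fin k) : (univ.image g).orderEmbOfFin hcard (f i) = g i := by
    simp only [f, ← coe_orderIsoOfFin_apply, OrderIso.apply_symm_apply]
  have hf_inj : Function.Injective f := fun i j h => hg (by rw [← hf i, ← hf j, h])
  let σ : Equiv.Perm (Fin k) := Equiv.ofBijective f (Finite.injective_iff_bijective.mp hf_inj)
  refine ⟨Equiv.Perm.sign σ, fun A => ?_⟩
  rw [minor_eq A hcard, colDet, colDet, ← Matrix.det_permute']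
  congr 1
  ext i j
  simp [σ, hf]

theorem abs_colDet {g : Fin k → Fin n} (hg : Function.Injective g)
    (A : Matrix (Fin k) (Fin n) ℝ) : |colDet A g| = |minor A (univ.image g)| := by
  obtain ⟨ε, hε⟩ := exists_sign_colDet hg
  rcases Int.units_eq_one_or ε with rfl | rfl <;> simp [hε]

/-- The matrix with entries `j ^ r`, whose maximal minors are all positive. -/
noncomputable def vander (k n : ℕ) : Matrix (Fin k) (Fin n) ℝ :=
  Matrix.of fun r j => (j : ℝ) ^ (r : ℕ)

theorem colDet_vander (g : Fin k → Fin n) :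
    colDet (vander k n) g = ∏ i, ∏ j ∈ Ioi i, ((g j : ℝ) - g i) := by
  rw [← Matrix.det_vandermonde, colDet, ← Matrix.det_transpose]
  rfl

theorem minor_vander_pos {I : Finset (Fin n)} (h : I.card = k) : 0 < minor (vander k n) I := by
  rw [minor_eq _ h, colDet_vander]
  refine prod_pos fun i _ => prod_pos fun j hj => sub_pos.mpr ?_
  exact_mod_cast (I.orderEmbOfFin h).strictMono (mem_Ioi.mp hj)

/-- The sign of the permutation sorting `g` is read off the Vandermonde matrix, whose minors are
positive. -/
theorem minor_image {g : Fin k → Fin n} (hg : Function.Injective g)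
    (A : Matrix (Fin k) (Fin n) ℝ) :
    minor A (univ.image g) =
      SignType.sign (∏ i, ∏ j ∈ Ioi i, ((g j : ℝ) - g i)) * colDet A g := by
  obtain ⟨ε, hε⟩ := exists_sign_colDet hg
  have hpos := minor_vander_pos (I := univ.image g) (k := k)
    (by simp [card_image_of_injective _ hg])
  rw [← colDet_vander, hε, hε, sign_mul, sign_pos hpos]
  rcases Int.units_eq_one_or ε with rfl | rfl <;> simp

theorem update_vecCons_vecCons_one {α : Type*} (x y z : α) (u : Fin m → α) :
    Function.update (Matrix.vecCons x (Matrix.vecCons y u)) 1 z =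
      Matrix.vecCons x (Matrix.vecCons z u) := by
  rw [Matrix.vecCons, ← Fin.succ_zero_eq_one, ← Fin.cons_update, Matrix.vecCons,
    Fin.update_cons_zero, Matrix.vecCons, Matrix.vecCons]

section TwoDet

variable {R : Type*} [CommRing R] (U : Fin m → Fin (m + 2) → R) (a b c d : Fin (m + 2) → R)

/-- The determinant with rows `x`, `y`, followed by the rows of `U`. -/
def twoDet (x y : Fin (m + 2) → R) : R :=
  (Matrix.of (Matrix.vecCons x (Matrix.vecCons y U))).det

/-- `twoDet U a` as a linear form. -/
def twoDetLin : (Fin (m + 2) → R) →ₗ[R] R :=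
  Matrix.detRowAlternating.toMultilinearMap.toLinearMap
    (Matrix.vecCons a (Matrix.vecCons 0 U)) 1

theorem twoDetLin_apply : twoDetLin U a b = twoDet U a b :=
  congrArg Matrix.det (update_vecCons_vecCons_one a 0 b U)

theorem twoDet_row (i : Fin m) : twoDet U a (U i) = 0 :=
  Matrix.det_zero_of_row_eq (i := 1) (j := i.succ.succ) (by simp [Fin.ext_iff]) rfl

theorem twoDet_swap : twoDet U a b = - twoDet U b a := by
  have h : Matrix.vecCons b (Matrix.vecCons a U) ∘ Equiv.swap 0 1 =
      Matrix.vecCons a (Matrix.vecCons b U) := by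
    funext i
    refine Fin.cases (by simp) (Fin.cases (by simp) fun i => ?_) i
    rw [Function.comp_apply, Equiv.swap_apply_of_ne_of_ne] <;> simp [Fin.ext_iff]
  have := Matrix.detRowAlternating.map_swap (Matrix.vecCons b (Matrix.vecCons a U)) zero_ne_one
  rwa [h] at this

/-- Cramer's rule for the rows `c`, `d`, `U 0`, `U 1`, …. -/
theorem exists_twoDet_smul_eq : ∃ q : Fin m → R,
    twoDet U c d • b = twoDet U b d • c + (twoDet U c b • d + ∑ i, q i • U i) := by
  set X : Matrix (Fin (m + 2)) (Fin (m + 2)) R :=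
    Matrix.of (Matrix.vecCons c (Matrix.vecCons d U))
  have hb : X.det • b = X.vecMul (X.transpose.cramer b) := by
    rw [← Matrix.mulVec_transpose, Matrix.mulVec_cramer, Matrix.det_transpose]
  have h0 : X.transpose.cramer b 0 = twoDet U b d := by
    rw [Matrix.cramer_transpose_apply]
    exact congrArg Matrix.det
      (Fin.update_cons_zero (α := fun _ => Fin (m + 2) → R) c (Matrix.vecCons d U) b)
  have h1 : X.transpose.cramer b 1 = twoDet U c b := by
    rw [Matrix.cramer_transpose_apply]
    exact congrArg Matrix.det (update_vecCons_vecCons_one c d b U)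
  refine ⟨fun i => X.transpose.cramer b i.succ.succ, ?_⟩
  rw [twoDet, hb, Matrix.vecMul_eq_sum, Fin.sum_univ_succ, Fin.sum_univ_succ, ← h0, ← h1]
  rfl

theorem twoDet_plucker :
    twoDet U a c * twoDet U b d = twoDet U a b * twoDet U c d + twoDet U a d * twoDet U b c := by
  obtain ⟨q, hq⟩ := exists_twoDet_smul_eq U b c d
  have h := congrArg (twoDetLin U a) hq
  simp only [map_add, map_smul, map_sum, twoDetLin_apply, twoDet_row, smul_eq_mul, mul_zero,
    sum_const_zero, add_zero] at h
  linear_combination -h - twoDet U a d * twoDet_swap U c b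

end TwoDet

theorem colDet_cons_cons (A : Matrix (Fin (m + 2)) (Fin n) ℝ) (u : Fin m → Fin n) (x y : Fin n) :
    colDet A (Matrix.vecCons x (Matrix.vecCons y u)) =
      twoDet (fun i => A.transpose (u i)) (A.transpose x) (A.transpose y) := by
  rw [colDet, ← Matrix.det_transpose, twoDet]
  congr 1
  ext i j
  refine Fin.cases ?_ (fun i => Fin.cases ?_ (fun i => ?_) i) i <;> rfl

/-- Reordering the columns of `S ∪ {x, y}` as `x, y, S` costs a sign that factors into a
contribution of `x` and a contribution of `y`. -/
theorem exists_minor_union_pair {S : Finset (Fin n)} (hS : S.card = m) :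
    ∃ (u : Fin m → Fin n) (η : ℝ) (ε : Fin n → ℝ), ∀ (A : Matrix (Fin (m + 2)) (Fin n) ℝ)
      (x y : Fin n), x < y → x ∉ S → y ∉ S → minor A (S ∪ {x, y}) =
        η * ε x * ε y * twoDet (fun i => A.transpose (u i)) (A.transpose x) (A.transpose y) := by
  let u := S.orderEmbOfFin hS
  let s : ℝ → ℝ := fun r => (SignType.sign r : ℝ)
  refine ⟨u, s (∏ i, ∏ j ∈ Ioi i, ((u j : ℝ) - u i)), fun x => s (∏ i, ((u i : ℝ) - x)),
    fun A x y hxy hx hy => ?_⟩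
  have hu_mem (i : Fin m) : u i ∈ S := S.orderEmbOfFin_mem hS i
  let g : Fin (m + 2) → Fin n := Matrix.vecCons x (Matrix.vecCons y u)
  have hg : Function.Injective g := by
    refine Fin.cons_injective_iff.mpr ⟨?_, Fin.cons_injective_iff.mpr ⟨?_, u.injective⟩⟩
    · rintro ⟨i, hi⟩
      induction i using Fin.cases with
      | zero => exact hxy.ne' hi
      | succ i => exact hx (hi ▸ hu_mem i)
    · rintro ⟨i, rfl⟩
      exact hy (hu_mem i)
  have hg_im : univ.image g = S ∪ {x, y} := by
    rw [← coe_inj, coe_image, coe_univ, Set.image_univ, Matrix.range_cons, Matrix.range_cons,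
      S.range_orderEmbOfFin]
    push_cast
    grind
  have hprod : ∏ i, ∏ j ∈ Ioi i, ((g j : ℝ) - g i) = ((y : ℝ) - x) * (∏ i, ((u i : ℝ) - x)) *
      ((∏ i, ((u i : ℝ) - y)) * ∏ i, ∏ j ∈ Ioi i, ((u j : ℝ) - u i)) := by
    simp only [Fin.prod_univ_succ (n := m + 1), Fin.prod_univ_succ (n := m), Fin.prod_Ioi_zero,
        Fin.prod_Ioi_succ, g, Matrix.cons_val_zero, Matrix.cons_val_succ]
  have hyx : SignType.sign ((y : ℝ) - x) = 1 := sign_pos (by simpa using hxy)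
  rw [← hg_im, minor_image hg, hprod, colDet_cons_cons]
  simp only [sign_mul, hyx, s, SignType.coe_mul, SignType.coe_one]
  ring

/-- `a < b < c < d` are elements outside `S`: the configuration in the three-term relations. -/
structure OrderedOutside (S : Finset (Fin n)) (a b c d : Fin n) : Prop where
  lt_ab : a < b
  lt_bc : b < c
  lt_cd : c < d
  a_notMem : a ∉ S
  b_notMem : b ∉ S
  c_notMem : c ∉ S
  d_notMem : d ∉ S

theorem minor_three_term (A : Matrix (Fin k) (Fin n) ℝ) {S : Finset (Fin n)} {a b c d : Fin n}
    (hS : S.card + 2 = k) (h : OrderedOutside S a b c d) :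
    minor A (S ∪ {a, c}) * minor A (S ∪ {b, d}) =
      minor A (S ∪ {a, b}) * minor A (S ∪ {c, d}) +
      minor A (S ∪ {a, d}) * minor A (S ∪ {b, c}) := by
  obtain ⟨hab, hbc, hcd, ha, hb, hc, hd⟩ := h
  subst hS
  obtain ⟨u, η, ε, hsign⟩ := exists_minor_union_pair (rfl : S.card = S.card)
  rw [hsign A a c (hab.trans hbc) ha hc, hsign A b d (hbc.trans hcd) hb hd, hsign A a b hab ha hb,
    hsign A c d hcd hc hd, hsign A a d (hab.trans (hbc.trans hcd)) ha hd, hsign A b c hbc hb hc]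
  linear_combination η * η * ε a * ε b * ε c * ε d * twoDet_plucker (fun i => A.transpose (u i))
    (A.transpose a) (A.transpose b) (A.transpose c) (A.transpose d)

end Minors

/-! ### Exchange inequalities for distance-like weights -/

section Exchange

variable {α : Type*} [DecidableEq α] {I J : Finset α} {i j x y z : α}

/-- The exchange `I - x + y` of matroid theory. -/
def exch (I : Finset α) (x y : α) : Finset α := insert y (I.erase x)

theorem mem_exch : z ∈ exch I x y ↔ z = y ∨ z ≠ x ∧ z ∈ I := by
  simp [exch]

theorem card_exch (hx : x ∈ I) (hy : y ∉ I) : (exch I x y).card = I.card := by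
  rw [exch, card_insert_of_notMem (by simp [hy]), card_erase_add_one hx]

theorem compl_exch [Fintype α] (hx : x ∈ I) (hy : y ∉ I) : (exch I x y)ᶜ = exch Iᶜ y x := by
  ext z
  grind [mem_exch, mem_compl]

/-- The weight `w` on finite sets grows by at most one along the moves `I ↦ I - x + y` with
`r x y`. -/
def IsLipschitz (r : α → α → Prop) (w : Finset α → ℕ) : Prop :=
  ∀ ⦃I x y⦄, x ∈ I → y ∉ I → r x y → w (exch I x y) ≤ w I + 1

theorem IsLipschitz.le_of_eq_exch {r : α → α → Prop} {w : Finset α → ℕ} (hw : IsLipschitz r w)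
    {K L : Finset α} (hx : x ∈ K) (hy : y ∉ K) (hr : r x y) (hL : L = exch K x y) :
    w L ≤ w K + 1 :=
  hL ▸ hw hx hy hr

/-- The symmetric exchange property of `I` and `J` for the weight `w`. -/
def HasExchange (w : Finset α → ℕ) (I J : Finset α) : Prop :=
  ∀ x ∈ I, x ∉ J → ∃ y ∈ J, y ∉ I ∧ w (exch I x y) + w (exch J y x) ≤ w I + w J

theorem HasExchange.compl [Fintype α] {w : Finset α → ℕ} (h : HasExchange w I J) :
    HasExchange (fun K => w Kᶜ) Jᶜ Iᶜ := by
  intro x hxJ hxI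
  rw [mem_compl] at hxJ
  rw [notMem_compl] at hxI
  obtain ⟨y, hyJ, hyI, h⟩ := h x hxI hxJ
  refine ⟨y, mem_compl.mpr hyI, notMem_compl.mpr hyJ, ?_⟩
  rw [← compl_exch hyJ hxJ, ← compl_exch hxI hyI]
  simpa only [compl_compl, add_comm] using h

section Step

variable {r : α → α → Prop} [Std.Symm r] {w : Finset α → ℕ}

variable (hw : IsLipschitz r w) (hji : r j i)
  (IH : ∀ I' J', I'.card = I.card → J'.card = J.card → w I' + w J' < w I + w J →
    HasExchange w I' J')
include hw hji IH

theorem hasExchange_of_descent_both (hjI : j ∈ I) (hiI : i ∉ I) (hjJ : j ∈ J) (hiJ : i ∉ J)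
    (hI : w (exch I j i) + 1 ≤ w I) (hJ : w (exch J j i) + 1 ≤ w J) : HasExchange w I J := by
  intro x hxI hxJ
  obtain ⟨y, hy, hy', h⟩ := IH (exch I j i) (exch J j i) (card_exch hjI hiI) (card_exch hjJ hiJ)
    (by lia) x (by grind [mem_exch]) (by grind [mem_exch])
  refine ⟨y, by grind [mem_exch], by grind [mem_exch], ?_⟩
  have h₁ : w (exch I x y) ≤ w (exch (exch I j i) x y) + 1 :=
    hw.le_of_eq_exch (x := i) (y := j) (by grind [mem_exch]) (by grind [mem_exch]) (symm_of r hji)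
      (by ext; grind [mem_exch])
  have h₂ : w (exch J y x) ≤ w (exch (exch J j i) y x) + 1 :=
    hw.le_of_eq_exch (x := i) (y := j) (by grind [mem_exch]) (by grind [mem_exch]) (symm_of r hji)
      (by ext; grind [mem_exch])
  lia

theorem exists_exchange_of_descent_entering (hjJ : j ∈ J) (hiJ : i ∉ J)
    (hJ : w (exch J j i) + 1 ≤ w J) (hiI : i ∈ I) :
    ∃ y ∈ J, y ∉ I ∧ w (exch I i y) + w (exch J y i) ≤ w I + w J := by
  by_cases hjI : j ∈ I
  · obtain ⟨y, hy, hyI, h⟩ := IH I (exch J j i) rfl (card_exch hjJ hiJ) (by lia) j hjI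
      (by grind [mem_exch])
    refine ⟨y, by grind [mem_exch], hyI, ?_⟩
    have h₁ : w (exch I i y) ≤ w (exch I j y) + 1 :=
      hw.le_of_eq_exch (x := i) (y := j) (by grind [mem_exch]) (by grind [mem_exch]) (symm_of r hji)
        (by ext; grind [mem_exch])
    have h₂ : exch J y i = exch (exch J j i) y j := by ext; grind [mem_exch]
    rw [h₂]
    lia
  · exact ⟨j, hjJ, hjI, by have := hw hiI hjI (symm_of r hji); lia⟩

theorem hasExchange_of_descent_right (hjJ : j ∈ J) (hiJ : i ∉ J)
    (hJ : w (exch J j i) + 1 ≤ w J) : HasExchange w I J := by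
  by_cases hboth : j ∈ I ∧ i ∉ I ∧ w (exch I j i) + 1 ≤ w I
  · exact hasExchange_of_descent_both hw hji IH hboth.1 hboth.2.1 hjJ hiJ hboth.2.2 hJ
  intro x hxI hxJ
  by_cases hxi : x = i
  · subst hxi
    exact exists_exchange_of_descent_entering hw hji IH hjJ hiJ hJ hxI
  obtain ⟨y, hy, hyI, h⟩ := IH I (exch J j i) rfl (card_exch hjJ hiJ) (by lia) x hxI
    (by grind [mem_exch])
  by_cases hyi : y = i
  swap
  · have h₂ : w (exch J y x) ≤ w (exch (exch J j i) y x) + 1 :=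
      hw.le_of_eq_exch (x := i) (y := j) (by grind [mem_exch]) (by grind [mem_exch]) (symm_of r hji)
        (by ext; grind [mem_exch])
    exact ⟨y, by grind [mem_exch], hyI, by lia⟩
  subst hyi
  have hexch : exch (exch J j y) y x = exch J j x := by ext; grind [mem_exch]
  rw [hexch] at h
  by_cases hjI : j ∈ I
  swap
  · have h₁ : w (exch I x j) ≤ w (exch I x y) + 1 :=
      hw.le_of_eq_exch (x := y) (y := j) (by grind [mem_exch]) (by grind [mem_exch]) (symm_of r hji)
        (by ext; grind [mem_exch])
    exact ⟨j, hjJ, hjI, by lia⟩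
  obtain ⟨z, hz, hz', h'⟩ := IH (exch I x y) (exch J j x) (card_exch hxI hyI) (card_exch hjJ hxJ)
    (by lia) j (by grind [mem_exch]) (by grind [mem_exch])
  by_cases hzx : z = x
  · have h₁ : exch (exch I x y) j z = exch I j y := by ext; grind [mem_exch]
    have h₂ : exch (exch J j x) z j = J := by ext; grind [mem_exch]
    rw [h₁, h₂] at h'
    exact absurd ⟨hjI, hyI, by lia⟩ hboth
  · have h₁ : w (exch I x z) ≤ w (exch (exch I x y) j z) + 1 :=
      hw.le_of_eq_exch (x := y) (y := j) (by grind [mem_exch]) (by grind [mem_exch]) (symm_of r hji)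
        (by ext; grind [mem_exch])
    have h₂ : exch J z x = exch (exch J j x) z j := by ext; grind [mem_exch]
    exact ⟨z, by grind [mem_exch], by grind [mem_exch], by rw [h₂]; lia⟩

end Step

/-- Induction on `w I + w J`, moving `I` or `J` one step towards the zero set of `w`;
complementation exchanges the roles of `I` and `J`. -/
theorem hasExchange_of_descent [Finite α] {r : α → α → Prop} [Std.Symm r] {w : Finset α → ℕ}
    {k : ℕ} (hw : IsLipschitz r w)
    (hdesc : ∀ I : Finset α, I.card = k → w I ≠ 0 →
      ∃ j ∈ I, ∃ i ∉ I, r j i ∧ w (exch I j i) + 1 ≤ w I)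
    (hzero : ∀ I J, w I = 0 → w J = 0 → HasExchange w I J) (hI : I.card = k) (hJ : J.card = k) :
    HasExchange w I J := by
  have := Fintype.ofFinite α
  induction hN : w I + w J using Nat.strong_induction_on generalizing I J with
  | _ N IH =>
    subst hN
    by_cases hJ0 : w J = 0
    swap
    · obtain ⟨j, hj, i, hi, hji, hlt⟩ := hdesc J hJ hJ0
      exact hasExchange_of_descent_right hw hji
        (fun I' J' hI' hJ' h => IH _ h (hI'.trans hI) (hJ'.trans hJ) rfl) hj hi hlt
    by_cases hI0 : w I = 0
    · exact hzero I J hI0 hJ0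
    obtain ⟨j, hj, i, hi, hji, hlt⟩ := hdesc I hI hI0
    have hcompl : HasExchange (fun K => w Kᶜ) Jᶜ Iᶜ := by
      refine hasExchange_of_descent_right (r := r) (i := j) (j := i) (fun K x y hx hy hxy => ?_)
        (symm_of r hji) (fun I' J' hI' hJ' h => ?_) (by simpa using hi) (by simpa using hj) ?_
      · rw [compl_exch hx hy]
        exact hw (by simpa using hy) (by simpa using hx) (symm_of r hxy)
      · simp only [compl_compl] at h
        have hI'k : I'ᶜ.card = k := by rw [card_compl, hI', ← card_compl, compl_compl, hJ]
        have hJ'k : J'ᶜ.card = k := by rw [card_compl, hJ', ← card_compl, compl_compl, hI]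
        simpa using (IH _ (by lia) hJ'k hI'k rfl).compl
      · rwa [compl_exch (by simpa using hi) (by simpa using hj), compl_compl]
    simpa using hcompl.compl

end Exchange

/-! ### Counting functions and sorting -/

section Counting

variable {n k : ℕ} {I J K L : Finset (Fin n)}

/-- The number of elements of `I` below `m`. -/
def cnt (I : Finset (Fin n)) (m : ℕ) : ℕ := (I.filter fun y => y.val < m).card

theorem cnt_zero (I : Finset (Fin n)) : cnt I 0 = 0 := by simp [cnt]

theorem cnt_eq_card (I : Finset (Fin n)) : cnt I n = I.card := by simp [cnt]

theorem cnt_succ (I : Finset (Fin n)) (y : Fin n) :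
    cnt I (y + 1) = cnt I y + if y ∈ I then 1 else 0 := by
  simp only [cnt, card_filter, ← sum_ite_eq' I y fun _ => 1, ← sum_add_distrib]
  refine sum_congr rfl fun z _ => ?_
  grind

theorem cnt_mono (I : Finset (Fin n)) : Monotone (cnt I) := fun _ _ h =>
  card_le_card (monotone_filter_right I fun _ _ hlt => hlt.trans_le h)

theorem cnt_exch {x y : Fin n} (hx : x ∈ I) (hy : y ∉ I) (m : ℕ) :
    cnt (exch I x y) m + (if x.val < m then 1 else 0) = cnt I m + if y.val < m then 1 else 0 := by
  simp only [cnt, exch, card_filter]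
  rw [sum_insert (by simp [hy]), add_assoc, sum_erase_add _ _ hx, add_comm]

theorem cnt_compl_add_cnt (I : Finset (Fin n)) {m : ℕ} (hm : m ≤ n) : cnt Iᶜ m + cnt I m = m := by
  simp only [cnt, card_filter]
  rw [sum_compl_add_sum, ← card_filter, Fin.card_filter_val_lt, min_eq_right hm]

theorem eq_of_cnt_eq (h : ∀ m ≤ n, cnt I m = cnt J m) : I = J := by
  ext y
  have h₀ := h y y.isLt.le
  have h₁ := h (y + 1) y.isLt
  rw [cnt_succ, cnt_succ] at h₁
  grind

theorem exists_cnt_eq (n : ℕ) {f : ℕ → ℕ} (h₀ : f 0 = 0)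
    (hf : ∀ m < n, f m ≤ f (m + 1) ∧ f (m + 1) ≤ f m + 1) :
    ∃ K : Finset (Fin n), ∀ m ≤ n, cnt K m = f m := by
  refine ⟨univ.filter fun y => f (y + 1) ≠ f y, fun m hm => ?_⟩
  induction m with
  | zero => rw [cnt_zero, h₀]
  | succ m ih =>
    have := hf m hm
    rw [cnt_succ _ ⟨m, hm⟩, ih (by lia)]
    simp only [mem_filter, mem_univ, true_and]
    split_ifs <;> lia

/-- `K` and `L` are obtained from `I` and `J` by sorting the multiset union and distributing it
alternately, starting with `K`: the counting functions of `K` and `L` are the upper and the lower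
average of those of `I` and `J`. -/
def IsSorting (I J K L : Finset (Fin n)) : Prop :=
  ∀ m ≤ n, cnt K m + cnt L m = cnt I m + cnt J m ∧ cnt L m ≤ cnt K m ∧ cnt K m ≤ cnt L m + 1

theorem exists_isSorting (I J : Finset (Fin n)) : ∃ K L, IsSorting I J K L := by
  have hstep (I : Finset (Fin n)) (m : ℕ) (hm : m < n) :
      cnt I m ≤ cnt I (m + 1) ∧ cnt I (m + 1) ≤ cnt I m + 1 := by
    have := cnt_succ I ⟨m, hm⟩
    grind
  obtain ⟨K, hK⟩ := exists_cnt_eq n (f := fun m => (cnt I m + cnt J m + 1) / 2)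
    (by simp [cnt_zero]) fun m hm => by have := hstep I m hm; have := hstep J m hm; lia
  obtain ⟨L, hL⟩ := exists_cnt_eq n (f := fun m => (cnt I m + cnt J m) / 2)
    (by simp [cnt_zero]) fun m hm => by have := hstep I m hm; have := hstep J m hm; lia
  exact ⟨K, L, fun m hm => by rw [hK m hm, hL m hm]; lia⟩

theorem IsSorting.card_eq (h : IsSorting I J K L) (hI : I.card = k) (hJ : J.card = k) :
    K.card = k ∧ L.card = k := by
  have := h n le_rfl
  simp only [cnt_eq_card] at this
  lia

/-- The relation `|x - y| = 1`. -/
def Adjacent (x y : Fin n) : Prop := x.val + 1 = y ∨ y.val + 1 = x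

instance : Std.Symm (Adjacent (n := n)) := ⟨fun _ _ => Or.symm⟩

/-- The `ℓ¹` distance of the counting functions of `I` and `B`. -/
def cntDist (I B : Finset (Fin n)) : ℕ :=
  ∑ m ∈ range (n + 1), ((cnt I m : ℤ) - cnt B m).natAbs

variable {B : Finset (Fin n)} {i j : Fin n}

theorem cntDist_eq_zero : cntDist I B = 0 ↔ I = B := by
  refine ⟨fun h => eq_of_cnt_eq fun m hm => ?_, fun h => by simp [h, cntDist]⟩
  have := sum_eq_zero_iff.mp h m (by simpa [Nat.lt_succ_iff] using hm)
  lia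

theorem cntDist_compl (I B : Finset (Fin n)) : cntDist Iᶜ Bᶜ = cntDist I B := by
  refine sum_congr rfl fun m hm => ?_
  have hm' := Nat.lt_succ_iff.mp (mem_range.mp hm)
  have := cnt_compl_add_cnt I hm'
  have := cnt_compl_add_cnt B hm'
  lia

theorem cntDist_exch_le (hj : j ∈ I) (hi : i ∉ I) (hji : Adjacent j i) (B : Finset (Fin n)) :
    cntDist (exch I j i) B ≤ cntDist I B + 1 := by
  have hle (m : ℕ) : ((cnt (exch I j i) m : ℤ) - cnt B m).natAbs ≤
      ((cnt I m : ℤ) - cnt B m).natAbs + if m = max j.val i then 1 else 0 := by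
    have := cnt_exch hj hi m
    rcases hji with h | h <;> grind
  calc cntDist (exch I j i) B
      ≤ cntDist I B + ∑ m ∈ range (n + 1), if m = max j.val i then 1 else 0 := by
        rw [cntDist, cntDist, ← sum_add_distrib]
        exact sum_le_sum fun m _ => hle m
    _ ≤ cntDist I B + 1 := by
        rw [sum_ite_eq']
        split_ifs <;> lia

theorem cntDist_exch_lt (hj : j ∈ I) (hi : i ∉ I) (hji : j.val + 1 = i)
    (hlt : cnt B i < cnt I i) : cntDist (exch I j i) B < cntDist I B := by
  have hexch (m : ℕ) := cnt_exch hj hi m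
  refine sum_lt_sum (fun m _ => ?_) ⟨i, by simp, ?_⟩
  · by_cases hm : m = i
    · have := hexch i
      grind
    · have := hexch m
      grind
  · have := hexch i
    grind

theorem exists_cnt_lt_boundary (hcard : I.card = B.card) {m : ℕ} (hm : m ≤ n)
    (hlt : cnt B m < cnt I m) :
    ∃ j ∈ I, ∃ i ∉ I, j.val + 1 = i ∧ cnt B i < cnt I i := by
  by_contra! hno
  obtain ⟨y, hyI, hylt⟩ : ∃ y ∈ I, cnt B (y + 1) < cnt I (y + 1) := by
    by_contra! hle
    suffices ∀ m ≤ n, cnt I m ≤ cnt B m from (this m hm).not_gt hlt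
    intro m
    induction m with
    | zero => simp [cnt_zero]
    | succ m ih =>
      intro hm
      by_cases hmI : ⟨m, hm⟩ ∈ I
      · exact hle _ hmI
      · have := ih (by lia)
        have := cnt_succ I ⟨m, hm⟩
        have := cnt_succ B ⟨m, hm⟩
        grind
  have hpersist : ∀ m : ℕ, y.val + 1 ≤ m → m ≤ n → cnt B m < cnt I m ∧ ∃ j ∈ I, j.val + 1 = m := by
    intro m hym
    induction m, hym using Nat.le_induction with
    | base => exact fun _ => ⟨hylt, y, hyI, rfl⟩
    | succ m _ ih =>
      intro hm
      obtain ⟨hlt, j, hj, hjm⟩ := ih (by lia)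
      have hmI : ⟨m, hm⟩ ∈ I := by
        by_contra hmI
        exact (hno j hj ⟨m, hm⟩ hmI hjm).not_gt hlt
      have := cnt_succ I ⟨m, hm⟩
      have := cnt_succ B ⟨m, hm⟩
      exact ⟨by grind, ⟨m, hm⟩, hmI, rfl⟩
  have := (hpersist n y.isLt le_rfl).1
  rw [cnt_eq_card, cnt_eq_card] at this
  lia

theorem exists_cntDist_exch_lt (hcard : I.card = B.card) (hne : I ≠ B) :
    ∃ j ∈ I, ∃ i ∉ I, Adjacent j i ∧ cntDist (exch I j i) B < cntDist I B := by
  obtain ⟨m, hm, hcnt⟩ : ∃ m ≤ n, cnt I m ≠ cnt B m := by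
    by_contra! h
    exact hne (eq_of_cnt_eq h)
  rcases hcnt.lt_or_gt with hlt | hlt
  swap
  · obtain ⟨j, hj, i, hi, hji, hlt⟩ := exists_cnt_lt_boundary hcard hm hlt
    exact ⟨j, hj, i, hi, .inl hji, cntDist_exch_lt hj hi hji hlt⟩
  have hcard' : Iᶜ.card = Bᶜ.card := by rw [card_compl, card_compl, hcard]
  obtain ⟨i, hi, j, hj, hij, hlt⟩ := exists_cnt_lt_boundary hcard' hm (by
    have := cnt_compl_add_cnt I hm
    have := cnt_compl_add_cnt B hm
    lia)
  have := cntDist_exch_lt hi hj hij hlt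
  rw [mem_compl] at hi
  rw [notMem_compl] at hj
  rw [← compl_exch hj hi, cntDist_compl, cntDist_compl] at this
  exact ⟨j, hj, i, hi, .inr hij, this⟩

theorem IsSorting.cntDist_add_le {B₁ B₂ C₁ C₂ : Finset (Fin n)} (h : IsSorting I J K L)
    (hC : IsSorting B₁ B₂ C₁ C₂) :
    cntDist K C₁ + cntDist L C₂ ≤ cntDist I B₁ + cntDist J B₂ := by
  simp only [cntDist, ← sum_add_distrib]
  refine sum_le_sum fun m hm => ?_
  have hm' := Nat.lt_succ_iff.mp (mem_range.mp hm)
  have := h m hm'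
  have := hC m hm'
  lia

end Counting

/-! ### The tropical three-term relation -/

section Weight

variable {n k : ℕ}

/-- The min-plus analogue of the three-term Plücker relation, for weights on `k`-sets. -/
def IsTropicalPositive (k : ℕ) (w : Finset (Fin n) → ℕ) : Prop :=
  ∀ ⦃S : Finset (Fin n)⦄ ⦃a b c d⦄, S.card + 2 = k → OrderedOutside S a b c d →
    w (S ∪ {a, c}) + w (S ∪ {b, d}) =
      min (w (S ∪ {a, b}) + w (S ∪ {c, d})) (w (S ∪ {a, d}) + w (S ∪ {b, c}))

theorem card_union_pair {α : Type*} [DecidableEq α] {S : Finset α} {x y : α} (hxy : x ≠ y)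
    (hx : x ∉ S) (hy : y ∉ S) : (S ∪ {x, y}).card = S.card + 2 := by
  rw [card_union_of_disjoint (by simp [hx, hy]), card_pair hxy]

theorem cnt_union_pair {S : Finset (Fin n)} {x y : Fin n} (hxy : x ≠ y) (hx : x ∉ S) (hy : y ∉ S)
    (m : ℕ) : cnt (S ∪ {x, y}) m =
      cnt S m + ((if x.val < m then 1 else 0) + if y.val < m then 1 else 0) := by
  simp only [cnt, card_filter]
  rw [sum_union (by simp [hx, hy]), sum_pair hxy]

namespace OrderedOutside

variable {S : Finset (Fin n)} {a b c d : Fin n} (h : OrderedOutside S a b c d)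
include h

theorem isSorting_ab_cd :
    IsSorting (S ∪ {a, b}) (S ∪ {c, d}) (S ∪ {a, c}) (S ∪ {b, d}) := by
  obtain ⟨hab, hbc, hcd, ha, hb, hc, hd⟩ := h
  intro m _
  rw [cnt_union_pair hab.ne ha hb, cnt_union_pair hcd.ne hc hd,
    cnt_union_pair (hab.trans hbc).ne ha hc, cnt_union_pair (hbc.trans hcd).ne hb hd]
  grind

theorem isSorting_ad_bc :
    IsSorting (S ∪ {a, d}) (S ∪ {b, c}) (S ∪ {a, c}) (S ∪ {b, d}) := by
  obtain ⟨hab, hbc, hcd, ha, hb, hc, hd⟩ := h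
  intro m _
  rw [cnt_union_pair (hab.trans (hbc.trans hcd)).ne ha hd, cnt_union_pair hbc.ne hb hc,
    cnt_union_pair (hab.trans hbc).ne ha hc, cnt_union_pair (hbc.trans hcd).ne hb hd]
  grind

theorem min_le_of_hasExchange {w : Finset (Fin n) → ℕ}
    (hw : HasExchange w (S ∪ {a, c}) (S ∪ {b, d})) :
    min (w (S ∪ {a, b}) + w (S ∪ {c, d})) (w (S ∪ {a, d}) + w (S ∪ {b, c})) ≤
      w (S ∪ {a, c}) + w (S ∪ {b, d}) := by
  obtain ⟨hab, hbc, hcd, ha, hb, -, hd⟩ := h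
  obtain ⟨y, hy, hy', h⟩ := hw a (by simp) (by grind)
  obtain rfl | rfl : y = b ∨ y = d := by grind
  · have h₁ : exch (S ∪ {a, c}) a y = S ∪ {y, c} := by ext; grind [mem_exch]
    have h₂ : exch (S ∪ {y, d}) y a = S ∪ {a, d} := by ext; grind [mem_exch]
    rw [h₁, h₂] at h
    lia
  · have h₁ : exch (S ∪ {a, c}) a y = S ∪ {c, y} := by ext; grind [mem_exch]
    have h₂ : exch (S ∪ {b, y}) y a = S ∪ {a, b} := by ext; grind [mem_exch]
    rw [h₁, h₂] at h
    lia

end OrderedOutside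

/-- The distance from `I` to the family `𝓑`, measured by counting functions (junk value `0`
if `𝓑` is empty). -/
noncomputable def cntWeight (𝓑 : Set (Finset (Fin n))) (I : Finset (Fin n)) : ℕ :=
  sInf (cntDist I '' 𝓑)

variable {𝓑 : Set (Finset (Fin n))} {I J K L B : Finset (Fin n)}

theorem cntWeight_le (hB : B ∈ 𝓑) (I : Finset (Fin n)) : cntWeight 𝓑 I ≤ cntDist I B :=
  Nat.sInf_le ⟨B, hB, rfl⟩

theorem exists_cntDist_eq_cntWeight (h𝓑 : 𝓑.Nonempty) (I : Finset (Fin n)) :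
    ∃ B ∈ 𝓑, cntDist I B = cntWeight 𝓑 I :=
  Nat.sInf_mem (h𝓑.image (cntDist I))

theorem cntWeight_eq_zero (h𝓑 : 𝓑.Nonempty) : cntWeight 𝓑 I = 0 ↔ I ∈ 𝓑 := by
  refine ⟨fun h => ?_, fun h => ?_⟩
  · obtain ⟨B, hB, hd⟩ := exists_cntDist_eq_cntWeight h𝓑 I
    rwa [cntDist_eq_zero.mp (hd.trans h)]
  · have := cntWeight_le h I
    rwa [cntDist_eq_zero.mpr rfl, Nat.le_zero] at this

theorem isLipschitz_cntWeight (h𝓑 : 𝓑.Nonempty) : IsLipschitz Adjacent (cntWeight 𝓑) := by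
  intro I j i hj hi hji
  obtain ⟨B, hB, hd⟩ := exists_cntDist_eq_cntWeight h𝓑 I
  exact (cntWeight_le hB _).trans (hd ▸ cntDist_exch_le hj hi hji B)

theorem exists_cntWeight_exch_lt (h𝓑 : 𝓑.Nonempty) (hcard : ∀ B ∈ 𝓑, B.card = k) (hI : I.card = k)
    (hne : cntWeight 𝓑 I ≠ 0) :
    ∃ j ∈ I, ∃ i ∉ I, Adjacent j i ∧ cntWeight 𝓑 (exch I j i) + 1 ≤ cntWeight 𝓑 I := by
  obtain ⟨B, hB, hd⟩ := exists_cntDist_eq_cntWeight h𝓑 I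
  have hIB : I ≠ B := by
    rintro rfl
    exact hne ((cntWeight_eq_zero h𝓑).mpr hB)
  obtain ⟨j, hj, i, hi, hji, hlt⟩ := exists_cntDist_exch_lt (hI.trans (hcard B hB).symm) hIB
  exact ⟨j, hj, i, hi, hji, hd ▸ (cntWeight_le hB _).trans_lt hlt⟩

/-- `𝓑` contains both sorted halves of any two of its members. -/
def SortClosed (𝓑 : Set (Finset (Fin n))) : Prop :=
  ∀ ⦃B₁⦄, B₁ ∈ 𝓑 → ∀ ⦃B₂⦄, B₂ ∈ 𝓑 → ∀ ⦃K L⦄, IsSorting B₁ B₂ K L → K ∈ 𝓑 ∧ L ∈ 𝓑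

theorem SortClosed.cntWeight_add_le (h : SortClosed 𝓑) (h𝓑 : 𝓑.Nonempty)
    (hKL : IsSorting I J K L) :
    cntWeight 𝓑 K + cntWeight 𝓑 L ≤ cntWeight 𝓑 I + cntWeight 𝓑 J := by
  obtain ⟨B₁, hB₁, hd₁⟩ := exists_cntDist_eq_cntWeight h𝓑 I
  obtain ⟨B₂, hB₂, hd₂⟩ := exists_cntDist_eq_cntWeight h𝓑 J
  obtain ⟨C₁, C₂, hC⟩ := exists_isSorting B₁ B₂
  obtain ⟨hC₁, hC₂⟩ := h hB₁ hB₂ hC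
  calc cntWeight 𝓑 K + cntWeight 𝓑 L ≤ cntDist K C₁ + cntDist L C₂ :=
        add_le_add (cntWeight_le hC₁ K) (cntWeight_le hC₂ L)
    _ ≤ cntDist I B₁ + cntDist J B₂ := hKL.cntDist_add_le hC
    _ = cntWeight 𝓑 I + cntWeight 𝓑 J := by rw [hd₁, hd₂]

theorem SortClosed.isTropicalPositive_cntWeight (h : SortClosed 𝓑) (h𝓑 : 𝓑.Nonempty)
    (hcard : ∀ B ∈ 𝓑, B.card = k)
    (hexch : ∀ I ∈ 𝓑, ∀ J ∈ 𝓑, ∀ x ∈ I, x ∉ J → ∃ y ∈ J, y ∉ I ∧ exch I x y ∈ 𝓑 ∧ exch J y x ∈ 𝓑) :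
    IsTropicalPositive k (cntWeight 𝓑) := by
  intro S a b c d hS hO
  refine le_antisymm (le_min (h.cntWeight_add_le h𝓑 hO.isSorting_ab_cd)
    (h.cntWeight_add_le h𝓑 hO.isSorting_ad_bc)) (hO.min_le_of_hasExchange ?_)
  have hzero (I J) (hI : cntWeight 𝓑 I = 0) (hJ : cntWeight 𝓑 J = 0) :
      HasExchange (cntWeight 𝓑) I J := by
    intro x hxI hxJ
    obtain ⟨y, hy, hyI, h₁, h₂⟩ := hexch I ((cntWeight_eq_zero h𝓑).mp hI) J
      ((cntWeight_eq_zero h𝓑).mp hJ) x hxI hxJ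
    refine ⟨y, hy, hyI, ?_⟩
    rw [(cntWeight_eq_zero h𝓑).mpr h₁, (cntWeight_eq_zero h𝓑).mpr h₂]
    exact Nat.zero_le _
  refine hasExchange_of_descent (isLipschitz_cntWeight h𝓑)
    (fun I hI => exists_cntWeight_exch_lt h𝓑 hcard hI) hzero (k := k) ?_ ?_
  · rw [card_union_pair (hO.lt_ab.trans hO.lt_bc).ne hO.a_notMem hO.c_notMem, hS]
  · rw [card_union_pair (hO.lt_bc.trans hO.lt_cd).ne hO.b_notMem hO.d_notMem, hS]

end Weight

/-! ### Bases and hyperplanes -/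

section BaseExchange

variable {α : Type*} {M : Matroid α} {B I J X : Set α} {x y z u : α}

theorem isBase_symm_exchange (hI : M.IsBase I) (hJ : M.IsBase J) (hxI : x ∈ I) (hxJ : x ∉ J) :
    ∃ y ∈ J, y ∉ I ∧ M.IsBase (insert y (I \ {x})) ∧ M.IsBase (insert x (J \ {y})) := by
  have hxE := hI.subset_ground hxI
  have hxcl : x ∈ M.closure J := by rwa [hJ.closure_eq]
  have hC := hJ.fundCircuit_isCircuit hxE hxJ
  -- the circuit of `J + x` cannot lie in the hyperplane spanned by `I - x`
  obtain ⟨y, ⟨hyC, hyx⟩, hy⟩ : ∃ y ∈ M.fundCircuit x J \ {x}, y ∉ M.closure (I \ {x}) := by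
    refine Set.not_subset.mp fun h => hI.indep.notMem_closure_sdiff_of_mem hxI ?_
    exact M.closure_subset_closure_of_subset_closure h
      (hC.mem_closure_sdiff_singleton_of_mem (M.mem_fundCircuit x J))
  have hyJ : y ∈ J := (M.fundCircuit_subset_insert x J hyC).resolve_left hyx
  obtain ⟨hyi, hyIx⟩ := ((hI.indep.sdiff {x}).notMem_closure_iff (hJ.subset_ground hyJ)).mp hy
  have hyI : y ∉ I := fun h => hyIx ⟨h, hyx⟩
  refine ⟨y, hyJ, hyI, hI.exchange_isBase_of_indep hyI hyi, ?_⟩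
  rw [Set.insert_sdiff_singleton_comm (Ne.symm hyx)]
  exact hJ.exchange_isBase_of_indep' hyJ hxJ ((hJ.indep.mem_fundCircuit_iff hxcl hxJ).mp hyC)

theorem isBase_insert_of_notMem_closure (hxI : x ∉ I) (hB : M.IsBase (insert x I))
    (hzE : z ∈ M.E) (hz : z ∉ M.closure I) : M.IsBase (insert z I) := by
  have hI : M.Indep I := hB.indep.subset (Set.subset_insert x I)
  obtain ⟨hzi, hzI⟩ := (hI.notMem_closure_iff hzE).mp hz
  exact Matroid.insert_isBase_of_insert_indep hxI hzI hB hzi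

theorem isBase_exchange_of_mem_fundCircuit (hB : M.IsBase B) (hIB : I ⊆ B) (hy : y ∈ M.closure I)
    (hyB : y ∉ B) (hu : u ∈ M.fundCircuit y I) (huy : u ≠ y) :
    M.IsBase (insert y B \ {u}) := by
  have hyI : y ∉ I := fun h => hyB (hIB h)
  have hC := (hB.indep.subset hIB).fundCircuit_isCircuit hy hyI
  have huI := (M.fundCircuit_subset_insert y I hu).resolve_left huy
  rw [hC.eq_fundCircuit_of_subset hB.indep
    ((M.fundCircuit_subset_insert y I).trans (Set.insert_subset_insert hIB)),
    hB.indep.mem_fundCircuit_iff (M.closure_subset_closure hIB hy) hyB] at hu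
  exact hB.exchange_isBase_of_indep' (hIB huI) hyB hu

theorem exists_hyperplane_of_not_spanning (hXE : X ⊆ M.E) (hX : ¬ M.Spanning X) :
    ∃ I x, x ∉ I ∧ M.IsBase (insert x I) ∧ X ⊆ M.closure I := by
  obtain ⟨I, hI⟩ := M.exists_isBasis X
  obtain ⟨B, hB, hIB⟩ := hI.indep.exists_isBase_superset
  obtain ⟨x, hxB, hxI⟩ : ∃ x ∈ B, x ∉ I := by
    refine Set.not_subset.mp fun hBI => hX ?_
    exact hB.spanning.superset (hBI.trans hI.subset)
  refine ⟨B \ {x}, x, by simp, by rwa [Set.insert_sdiff_self_of_mem hxB], ?_⟩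
  exact hI.subset_closure.trans
    (M.closure_subset_closure (Set.subset_sdiff_singleton hIB hxI))

theorem isBase_of_spanning_of_encard_eq (hX : M.Spanning X) (hfin : X.Finite)
    (hcard : X.encard = M.eRank) : M.IsBase X := by
  obtain ⟨I, hI⟩ := M.exists_isBasis X
  have hIB := hI.isBase_of_spanning hX
  have hIX : I = X := hfin.eq_of_subset_of_encard_le' hI.subset
    (by rw [hcard, hIB.encard_eq_eRank])
  exact hIX ▸ hIB

end BaseExchange

/-! ### Matroids satisfying the positive three-term condition -/

section PosThreeTerm

variable {n k : ℕ} {M : Matroid (Fin n)} {I J K L N S X A : Finset (Fin n)} {x y p q : Fin n}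

theorem coe_exch (I : Finset (Fin n)) (x y : Fin n) :
    (exch I x y : Set (Fin n)) = insert y ((I : Set (Fin n)) \ {x}) := by
  simp [exch]

theorem isBase_symm_exch (hI : M.IsBase I) (hJ : M.IsBase J) (hxI : x ∈ I) (hxJ : x ∉ J) :
    ∃ y ∈ J, y ∉ I ∧ M.IsBase (exch I x y) ∧ M.IsBase (exch J y x) := by
  obtain ⟨y, hyJ, hyI, h₁, h₂⟩ :=
    isBase_symm_exchange hI hJ (mem_coe.mpr hxI) (by rwa [mem_coe])
  exact ⟨y, mem_coe.mp hyJ, by rwa [mem_coe] at hyI, by rwa [coe_exch], by rwa [coe_exch]⟩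

theorem card_eq_of_isBase (hk : M.eRank = k) (hI : M.IsBase I) : I.card = k := by
  have := hI.encard_eq_eRank
  rwa [hk, Set.encard_coe_eq_coe_finsetCard, Nat.cast_inj] at this

/-- The matroid analogue of the three-term Plücker relation for matrices with nonnegative maximal
minors: two opposite sides of the square `S + {ab, bc, cd, da}` force both diagonals. -/
def PosThreeTerm (M : Matroid (Fin n)) : Prop :=
  ∀ ⦃S : Finset (Fin n)⦄ ⦃a b c d⦄, OrderedOutside S a b c d →
    (M.IsBase ↑(S ∪ {a, b}) ∧ M.IsBase ↑(S ∪ {c, d})) ∨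
      (M.IsBase ↑(S ∪ {a, d}) ∧ M.IsBase ↑(S ∪ {b, c})) →
    M.IsBase ↑(S ∪ {a, c}) ∧ M.IsBase ↑(S ∪ {b, d})

/-- `A` is an interval in the cyclic order of `Fin n`. -/
def IsCyclicInterval (A : Finset (Fin n)) : Prop :=
  (A : Set (Fin n)).OrdConnected ∨ ((Aᶜ : Finset (Fin n)) : Set (Fin n)).OrdConnected

theorem exists_card_inter_add_cnt (hA : (A : Set (Fin n)).OrdConnected) :
    ∃ a b : ℕ, a ≤ b ∧ b ≤ n ∧ ∀ K : Finset (Fin n), (K ∩ A).card + cnt K a = cnt K b := by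
  obtain rfl | hne := A.eq_empty_or_nonempty
  · exact ⟨0, 0, le_rfl, Nat.zero_le n, fun K => by simp⟩
  have hmem (y : Fin n) : y ∈ A ↔ A.min' hne ≤ y ∧ y ≤ A.max' hne :=
    ⟨fun hy => ⟨min'_le A y hy, le_max' A y hy⟩,
      fun hy => mem_coe.mp (hA.out (min'_mem A hne) (max'_mem A hne) hy)⟩
  have hle : A.min' hne ≤ A.max' hne := min'_le _ _ (max'_mem A hne)
  refine ⟨A.min' hne, A.max' hne + 1, by lia, (A.max' hne).isLt, fun K => ?_⟩
  rw [cnt, cnt, ← card_union_of_disjoint (by rw [disjoint_left]; grind)]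
  congr 1
  ext y
  grind

theorem IsSorting.card_inter_le (h : IsSorting I J K L) (hI : I.card = k) (hJ : J.card = k)
    (hA : IsCyclicInterval A) :
    (K ∩ A).card ≤ max (I ∩ A).card (J ∩ A).card ∧
      (L ∩ A).card ≤ max (I ∩ A).card (J ∩ A).card := by
  obtain ⟨hK, hL⟩ := h.card_eq hI hJ
  have hcompl (K : Finset (Fin n)) : (K ∩ Aᶜ).card + (K ∩ A).card = K.card := by
    rw [← sdiff_eq_inter_compl, card_sdiff_add_card_inter]
  obtain hA | hA := hA <;> obtain ⟨a, b, hab, hbn, hcard⟩ := exists_card_inter_add_cnt hA <;>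
  · have := h a (hab.trans hbn)
    have := h b hbn
    grind

/-- The number of the gap of the cyclic order between consecutive elements of `N` in which
`y ∉ N` lies. -/
def gapLabel (N : Finset (Fin n)) (y : Fin n) : ℕ := cnt N y % N.card

theorem cnt_le_card (N : Finset (Fin n)) (m : ℕ) : cnt N m ≤ N.card := card_filter_le _ _

theorem gapLabel_eq_ite (N : Finset (Fin n)) (y : Fin n) :
    gapLabel N y = if cnt N y = N.card then 0 else cnt N y := by
  rw [gapLabel]
  split_ifs with h
  · rw [h, Nat.mod_self]
  · exact Nat.mod_eq_of_lt ((cnt_le_card N y).lt_of_ne h)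

theorem isCyclicInterval_gap (N : Finset (Fin n)) (g : ℕ) :
    IsCyclicInterval (univ.filter fun y => y ∉ N ∧ gapLabel N y = g) := by
  have hmono {y z : Fin n} (h : y ≤ z) : cnt N y ≤ cnt N z ∧ cnt N (y + 1) ≤ cnt N (z + 1) :=
    ⟨cnt_mono N h, cnt_mono N (Nat.succ_le_succ h)⟩
  obtain rfl | hg := eq_or_ne g 0
  · right
    convert_to ({y | 0 < cnt N (y + 1) ∧ cnt N y < N.card} : Set (Fin n)).OrdConnected
    · ext y
      have := cnt_succ N y
      have := cnt_le_card N (y + 1)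
      simp only [coe_compl, coe_filter, mem_univ, true_and, gapLabel_eq_ite, Set.mem_compl_iff,
        Set.mem_ofPred_eq]
      grind
    · exact ⟨fun y hy z hz t ht => ⟨hy.1.trans_le (hmono ht.1).2, (hmono ht.2).1.trans_lt hz.2⟩⟩
  · left
    convert_to ({y | g ≤ cnt N y ∧ cnt N (y + 1) ≤ g ∧ g < N.card} : Set (Fin n)).OrdConnected
    · ext y
      have := cnt_succ N y
      have := cnt_le_card N y
      simp only [coe_filter, mem_univ, true_and, gapLabel_eq_ite, Set.mem_ofPred_eq]
      grind
    · exact ⟨fun y hy z hz t ht => ⟨hy.1.trans (hmono ht.1).1, (hmono ht.2).2.trans hz.2.1, hz.2.2⟩⟩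

theorem exists_crossing_of_gapLabel_ne (hp : p ∉ N) (hq : q ∉ N) (hpq : p < q)
    (hne : gapLabel N p ≠ gapLabel N q) :
    (∃ z ∈ N, p < z ∧ z < q) ∧ ∃ z ∈ N, z < p ∨ q < z := by
  constructor
  · by_contra! hno
    refine hne (congrArg (· % N.card) (congrArg card (filter_congr fun z hz => ?_)))
    grind
  · by_contra! hno
    have h₀ : cnt N p = 0 := card_eq_zero.mpr (filter_eq_empty_iff.mpr fun z hz => by grind)
    have h₁ : cnt N q = N.card := congrArg card (filter_eq_self.mpr fun z hz => by grind)
    exact hne (by simp [gapLabel, h₀, h₁])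

theorem PosThreeTerm.gapLabel_eq (hM : PosThreeTerm M) (hpN : p ∉ N) (hqN : q ∉ N) (hpS : p ∉ S)
    (hqS : q ∉ S) (hNS : Disjoint N S) (hp : ∀ z ∈ N, M.IsBase ↑(S ∪ {p, z}))
    (hq : ∀ z ∈ N, M.IsBase ↑(S ∪ {q, z})) (hpq : ¬ M.IsBase ↑(S ∪ {p, q})) :
    gapLabel N p = gapLabel N q := by
  wlog hlt : p < q generalizing p q
  · obtain rfl | hne := eq_or_ne p q
    · rfl
    · exact (this hqN hpN hqS hpS hq hp (by rwa [pair_comm]) (by lia)).symm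
  by_contra hne
  obtain ⟨⟨z, hz, hpz, hzq⟩, z', hz', hout⟩ := exists_crossing_of_gapLabel_ne hpN hqN hlt hne
  have hzS := disjoint_left.mp hNS hz
  have hzS' := disjoint_left.mp hNS hz'
  rcases hout with hz'p | hqz'
  · refine hpq (hM ⟨hz'p, hpz, hzq, hzS', hpS, hzS, hqS⟩ (.inl ⟨?_, ?_⟩)).2
    · rw [pair_comm]; exact hp z' hz'
    · rw [pair_comm]; exact hq z hz
  · exact hpq (hM ⟨hpz, hzq, hqz', hpS, hzS, hqS, hzS'⟩ (.inl ⟨hp z hz, hq z' hz'⟩)).1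

/-- Fundamental circuits inside a hyperplane do not leave the gaps between the elements of its
complement `N`. -/
theorem PosThreeTerm.gapLabel_eq_of_mem_fundCircuit (hM : PosThreeTerm M)
    (hN : ∀ z, z ∈ N ↔ z ∉ M.closure I) (hne : N.Nonempty) (hI : ∀ z ∈ N, M.IsBase ↑(insert z I))
    (hIE : (I : Set (Fin n)) ⊆ M.E) {u : Fin n}
    (hy : y ∈ M.closure I) (hyI : y ∉ I) (hu : u ∈ M.fundCircuit y I) (huy : u ≠ y) :
    gapLabel N u = gapLabel N y := by
  have huI : u ∈ I := (M.fundCircuit_subset_insert y I hu).resolve_left huy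
  have hIcl := M.subset_closure (I : Set (Fin n)) hIE
  have hucl := hIcl huI
  have hnot (z) (hz : z ∈ I) : z ∉ N := fun h => (hN z).mp h (hIcl hz)
  refine hM.gapLabel_eq (S := I.erase u) (fun h => (hN u).mp h hucl) (fun h => (hN y).mp h hy)
    (notMem_erase u I) (fun h => hyI (mem_of_mem_erase h))
    (disjoint_left.mpr fun z hz h => hnot z (mem_of_mem_erase h) hz) (fun z hz => ?_)
    (fun z hz => ?_) fun hb => ?_
  · convert hI z hz using 2
    grind
  · have hyz : y ≠ z := fun h => (hN z).mp hz (h ▸ hy)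
    have huz : u ≠ z := fun h => (hN z).mp hz (h ▸ hucl)
    convert isBase_exchange_of_mem_fundCircuit (hI z hz) (by simp) hy (by simp [hyz, hyI]) hu huy
      using 1
    ext t
    simp only [union_insert, union_singleton, coe_insert, coe_erase, Set.mem_insert_iff,
      Set.mem_sdiff, mem_coe, Set.mem_singleton_iff]
    grind
  · obtain ⟨z, hz⟩ := hne
    refine (hN z).mp hz ?_
    refine M.closure_subset_closure_of_subset_closure (X := ↑(I.erase u ∪ {u, y})) ?_ ?_
    · intro t ht
      obtain ht | rfl : t ∈ I ∨ t = y := by grind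
      · exact hIcl ht
      · exact hy
    · rw [hb.closure_eq]
      exact (hI z hz).subset_ground (by simp)

theorem PosThreeTerm.mem_closure_gap (hM : PosThreeTerm M)
    (hN : ∀ z, z ∈ N ↔ z ∉ M.closure I) (hne : N.Nonempty) (hI : ∀ z ∈ N, M.IsBase ↑(insert z I))
    (hy : y ∈ M.closure I) :
    y ∈ M.closure ↑(I.filter fun u => gapLabel N u = gapLabel N y) := by
  have hIi : M.Indep I := (hI _ hne.choose_spec).indep.subset (by simp)
  have hsub : ((I.filter fun u => gapLabel N u = gapLabel N y : Finset (Fin n)) : Set (Fin n)) ⊆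
      M.E := (coe_subset.mpr (filter_subset _ I)).trans hIi.subset_ground
  by_cases hyI : y ∈ I
  · exact M.mem_closure_of_mem (by simp [hyI]) hsub
  have hC := hIi.fundCircuit_isCircuit hy hyI
  refine M.closure_subset_closure ?_
    (hC.mem_closure_sdiff_singleton_of_mem (M.mem_fundCircuit y I))
  rintro u ⟨huC, huy⟩
  simp only [coe_filter, Set.mem_ofPred_eq]
  exact ⟨(M.fundCircuit_subset_insert y I huC).resolve_left huy,
    hM.gapLabel_eq_of_mem_fundCircuit hN hne hI hIi.subset_ground hy hyI huC huy⟩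

theorem PosThreeTerm.eRk_gap_le (hM : PosThreeTerm M)
    (hN : ∀ z, z ∈ N ↔ z ∉ M.closure I) (hne : N.Nonempty) (hI : ∀ z ∈ N, M.IsBase ↑(insert z I))
    (g : ℕ) :
    M.eRk ↑(univ.filter fun y => y ∉ N ∧ gapLabel N y = g) ≤
      (I.filter fun u => gapLabel N u = g).card := by
  have hsub : ((univ.filter fun y => y ∉ N ∧ gapLabel N y = g : Finset (Fin n)) : Set (Fin n)) ⊆
      M.closure ↑(I.filter fun u => gapLabel N u = g) := by
    intro y hy
    obtain ⟨hyN, rfl⟩ : y ∉ N ∧ gapLabel N y = g := by simpa using hy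
    exact hM.mem_closure_gap hN hne hI (not_not.mp ((hN y).not.mp hyN))
  calc M.eRk ↑(univ.filter fun y => y ∉ N ∧ gapLabel N y = g)
      ≤ M.eRk (M.closure ↑(I.filter fun u => gapLabel N u = g)) := M.eRk_mono hsub
    _ ≤ (I.filter fun u => gapLabel N u = g).card := by
        rw [Matroid.eRk_closure_eq, ← Set.encard_coe_eq_coe_finsetCard]
        exact M.eRk_le_encard _

/-- The basis polytope of a matroid satisfying the positive three-term condition is cut out of the
hypersimplex by the rank inequalities of cyclic intervals. -/
theorem PosThreeTerm.isBase_of_card_inter_le (hM : PosThreeTerm M) (hE : M.E = Set.univ)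
    (hX : (X.card : ℕ∞) = M.eRank)
    (hle : ∀ A : Finset (Fin n), IsCyclicInterval A → ((X ∩ A).card : ℕ∞) ≤ M.eRk A) :
    M.IsBase X := by
  classical
  have hXc : (X : Set (Fin n)).encard = M.eRank := by rwa [Set.encard_coe_eq_coe_finsetCard]
  by_contra hXB
  obtain ⟨I, x, hxI, hB, hXI⟩ := exists_hyperplane_of_not_spanning (hE ▸ Set.subset_univ _)
    fun h => hXB (isBase_of_spanning_of_encard_eq h X.finite_toSet hXc)
  lift I to Finset (Fin n) using Set.toFinite I
  let N : Finset (Fin n) := univ.filter fun z => z ∉ M.closure I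
  have hN (z) : z ∈ N ↔ z ∉ M.closure I := by simp [N]
  have hxN : x ∈ N := by
    have := hB.indep.notMem_closure_sdiff_of_mem (Set.mem_insert x _)
    rwa [Set.insert_sdiff_self_of_notMem hxI, ← hN] at this
  have hins (z) (hz : z ∈ N) : M.IsBase ↑(insert z I) := by
    rw [coe_insert]
    exact isBase_insert_of_notMem_closure hxI hB (hE ▸ Set.mem_univ z) ((hN z).mp hz)
  have hgap (g : ℕ) :
      (X.filter fun u => gapLabel N u = g).card ≤ (I.filter fun u => gapLabel N u = g).card := by
    have := (hle _ (isCyclicInterval_gap N g)).trans (hM.eRk_gap_le hN ⟨x, hxN⟩ hins g)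
    rw [Nat.cast_le] at this
    refine le_of_eq_of_le (congrArg card ?_) this
    ext y
    have : y ∈ X → y ∉ N := fun hy h => (hN y).mp h (hXI hy)
    grind
  have hmaps (Y : Finset (Fin n)) : Set.MapsTo (gapLabel N) Y (range N.card) := fun y _ =>
    mem_coe.mpr (mem_range.mpr (Nat.mod_lt _ (card_pos.mpr ⟨x, hxN⟩)))
  have hXI : X.card ≤ I.card := by
    rw [card_eq_sum_card_fiberwise (hmaps X), card_eq_sum_card_fiberwise (hmaps I)]
    exact sum_le_sum fun g _ => hgap g
  have := hX.trans hB.encard_eq_eRank.symm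
  rw [← coe_insert, Set.encard_coe_eq_coe_finsetCard, Nat.cast_inj,
    card_insert_of_notMem (by simpa using hxI)] at this
  lia

theorem PosThreeTerm.sortClosed (hM : PosThreeTerm M) (hE : M.E = Set.univ) (hk : M.eRank = k) :
    SortClosed {B : Finset (Fin n) | M.IsBase B} := by
  intro I hI J hJ K L h
  have hIk := card_eq_of_isBase hk hI
  have hJk := card_eq_of_isBase hk hJ
  obtain ⟨hK, hL⟩ := h.card_eq hIk hJk
  have hrk {B : Finset (Fin n)} (hB : M.IsBase B) (A : Finset (Fin n)) :
      ((B ∩ A).card : ℕ∞) ≤ M.eRk A := by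
    rw [← Set.encard_coe_eq_coe_finsetCard]
    exact (hB.indep.subset (by simp)).encard_le_eRk_of_subset (by simp)
  have hmax (A : Finset (Fin n)) :
      ((max (I ∩ A).card (J ∩ A).card : ℕ) : ℕ∞) ≤ M.eRk A := by
    rcases max_choice (I ∩ A).card (J ∩ A).card with h | h <;> rw [h]
    exacts [hrk hI A, hrk hJ A]
  exact ⟨hM.isBase_of_card_inter_le hE (by rw [hK, hk]) fun A hA =>
      (Nat.cast_le.mpr (h.card_inter_le hIk hJk hA).1).trans (hmax A),
    hM.isBase_of_card_inter_le hE (by rw [hL, hk]) fun A hA =>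
      (Nat.cast_le.mpr (h.card_inter_le hIk hJk hA).2).trans (hmax A)⟩

theorem PosThreeTerm.exists_isTropicalPositive (hM : PosThreeTerm M) (hE : M.E = Set.univ)
    (hk : M.eRank = k) :
    ∃ w : Finset (Fin n) → ℕ, IsTropicalPositive k w ∧ ∀ I, w I = 0 ↔ M.IsBase ↑I := by
  obtain ⟨B, hB⟩ := M.exists_isBase
  lift B to Finset (Fin n) using Set.toFinite B
  have hne : {B : Finset (Fin n) | M.IsBase B}.Nonempty := ⟨B, hB⟩
  exact ⟨_, (hM.sortClosed hE hk).isTropicalPositive_cntWeight hne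
    (fun I hI => card_eq_of_isBase hk hI) fun I hI J hJ x hxI hxJ => isBase_symm_exch hI hJ hxI hxJ,
    fun I => cntWeight_eq_zero hne⟩

end PosThreeTerm

/-! ### Realizing tropically positive weights -/

section HasOrder

/-- `f` is positive near `0⁺` and vanishes there to order exactly `e`. -/
def HasOrder (f : ℝ → ℝ) (e : ℕ) : Prop :=
  (∀ᶠ t in 𝓝[>] 0, 0 < f t) ∧ f =Θ[𝓝[>] 0] fun t => t ^ e

variable {f g : ℝ → ℝ} {a b : ℕ}

theorem HasOrder.pow (e : ℕ) : HasOrder (fun t => t ^ e) e :=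
  ⟨eventually_mem_nhdsWithin.mono fun _ ht => pow_pos ht e, isTheta_refl _ _⟩

theorem HasOrder.mul_const (hf : HasOrder f a) {r : ℝ} (hr : 0 < r) :
    HasOrder (fun t => f t * r) a :=
  ⟨hf.1.mono fun _ ht => mul_pos ht hr, by
    simpa using hf.2.mul (isTheta_const_const hr.ne' (one_ne_zero (α := ℝ)))⟩

theorem HasOrder.congr (hf : HasOrder f a) (hfg : f =ᶠ[𝓝[>] 0] g) : HasOrder g a :=
  ⟨by filter_upwards [hf.1, hfg] with t ht h using h ▸ ht, hfg.symm.trans_isTheta hf.2⟩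

theorem HasOrder.mul (hf : HasOrder f a) (hg : HasOrder g b) :
    HasOrder (fun t => f t * g t) (a + b) := by
  refine ⟨by filter_upwards [hf.1, hg.1] with t using mul_pos, ?_⟩
  simpa only [pow_add] using hf.2.mul hg.2

theorem HasOrder.div (hf : HasOrder f (a + b)) (hg : HasOrder g b) :
    HasOrder (fun t => f t / g t) a := by
  refine ⟨by filter_upwards [hf.1, hg.1] with t using div_pos,
    (hf.2.div hg.2).trans_eventuallyEq ?_⟩
  filter_upwards [self_mem_nhdsWithin] with t (ht : 0 < t)
  rw [pow_add, mul_div_cancel_right₀ _ (pow_pos ht b).ne']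

theorem HasOrder.add (hf : HasOrder f a) (hg : HasOrder g b) :
    HasOrder (fun t => f t + g t) (min a b) := by
  wlog hab : a ≤ b generalizing f g a b
  · simpa only [add_comm, min_comm] using this hg hf (le_of_not_ge hab)
  rw [min_eq_left hab]
  refine ⟨by filter_upwards [hf.1, hg.1] with t using add_pos, ?_, ?_⟩
  · refine hf.2.isBigO.add (hg.2.isBigO.trans (IsBigO.of_bound' ?_))
    filter_upwards [Ioo_mem_nhdsGT zero_lt_one] with t ⟨h0, h1⟩
    rw [norm_pow, norm_pow, Real.norm_of_nonneg h0.le]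
    exact pow_le_pow_of_le_one h0.le h1.le hab
  · refine hf.2.isBigO_symm.trans (IsBigO.of_bound' ?_)
    filter_upwards [hf.1, hg.1] with t hft hgt
    rw [Real.norm_of_nonneg hft.le, Real.norm_of_nonneg (by positivity)]
    linarith

theorem HasOrder.isBigO_one (hf : HasOrder f a) : f =O[𝓝[>] 0] fun _ => (1 : ℝ) :=
  hf.2.isBigO.trans
    ((((continuous_pow a).tendsto (0 : ℝ)).mono_left nhdsWithin_le_nhds).isBigO_one ℝ)

theorem HasOrder.nonneg_and_ne_zero_iff_of_tendsto (hf : HasOrder f a) {l : Filter ℝ} [l.NeBot]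
    (hl : l ≤ 𝓝[>] 0) {r : ℝ} (hr : Tendsto f l (𝓝 r)) : 0 ≤ r ∧ (r ≠ 0 ↔ a = 0) := by
  refine ⟨ge_of_tendsto hr (hl (hf.1.mono fun _ ht => ht.le)), not_iff_comm.mp ?_⟩
  have hpow : Tendsto (fun t : ℝ => t ^ a) l (𝓝 (0 ^ a)) :=
    ((continuous_pow a).tendsto 0).mono_left (hl.trans nhdsWithin_le_nhds)
  have hiff := (hf.2.mono hl).tendsto_zero_iff
  constructor
  · intro ha
    rw [zero_pow ha] at hpow
    exact tendsto_nhds_unique hr (hiff.mpr hpow)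
  · rintro rfl rfl
    simpa using tendsto_nhds_unique hpow (hiff.mp hr)

end HasOrder

section Columns

variable {n k : ℕ}

theorem colDet_update (A : Matrix (Fin k) (Fin n) ℝ) (g : Fin k → Fin n) (i : Fin k) (j : Fin n) :
    colDet A (Function.update g i j) = ((A.submatrix id g).updateCol i (A.col j)).det := by
  rw [colDet]
  congr 1
  ext r s
  obtain rfl | hs := eq_or_ne s i <;> simp [*]

theorem minor_mul_left (C : Matrix (Fin k) (Fin k) ℝ) (A : Matrix (Fin k) (Fin n) ℝ)
    (I : Finset (Fin n)) : minor (C * A) I = C.det * minor A I := by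
  by_cases h : I.card = k
  · rw [minor_eq _ h, minor_eq _ h, colDet, colDet, ← Matrix.det_mul]
    rfl
  · simp [minor, h]

theorem minor_updateCol_of_notMem (A : Matrix (Fin k) (Fin n) ℝ) {μ : Fin n} {I : Finset (Fin n)}
    (hμ : μ ∉ I) (x : Fin k → ℝ) : minor (A.updateCol μ x) I = minor A I := by
  by_cases h : I.card = k
  · rw [minor_eq _ h, minor_eq _ h, colDet, colDet]
    congr 1
    ext i j
    have : I.orderEmbOfFin h j ≠ μ := fun e => hμ (e ▸ I.orderEmbOfFin_mem h j)
    simp [this]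
  · simp [minor, h]

theorem exists_orderEmbOfFin_eq {I : Finset (Fin n)} (h : I.card = k) {μ : Fin n} (hμ : μ ∈ I) :
    ∃ i, I.orderEmbOfFin h i = μ := by
  rwa [← Set.mem_range, range_orderEmbOfFin]

theorem minor_updateCol (A : Matrix (Fin k) (Fin n) ℝ) {I : Finset (Fin n)} (h : I.card = k)
    (i : Fin k) (x : Fin k → ℝ) :
    minor (A.updateCol (I.orderEmbOfFin h i) x) I =
      ((A.submatrix id (I.orderEmbOfFin h)).updateCol i x).det := by
  rw [minor_eq _ h, colDet]
  congr 1
  ext r s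
  simp [Matrix.updateCol_apply]

theorem exists_linearMap_minor_updateCol (A : Matrix (Fin k) (Fin n) ℝ) {μ : Fin n}
    {I : Finset (Fin n)} (h : I.card = k) (hμ : μ ∈ I) :
    ∃ φ : (Fin k → ℝ) →ₗ[ℝ] ℝ, ∀ x, φ x = minor (A.updateCol μ x) I := by
  obtain ⟨i, rfl⟩ := exists_orderEmbOfFin_eq h hμ
  refine ⟨Matrix.detRowAlternating.toMultilinearMap.toLinearMap
    (A.submatrix id (I.orderEmbOfFin h)).transpose i, fun x => ?_⟩
  rw [minor_updateCol, ← Matrix.det_transpose, ← Matrix.updateRow_transpose]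
  rfl

theorem minor_updateCol_col_eq_zero (A : Matrix (Fin k) (Fin n) ℝ) {μ l : Fin n}
    {T : Finset (Fin n)} (hμ : μ ∉ T) (hT : T.card + 1 = k) (hl : l ∈ T) :
    minor (A.updateCol μ (A.col l)) (insert μ T) = 0 := by
  have h : (insert μ T).card = k := by rw [card_insert_of_notMem hμ, hT]
  obtain ⟨i, hi⟩ := exists_orderEmbOfFin_eq h (mem_insert_self μ T)
  obtain ⟨j, hj⟩ := exists_orderEmbOfFin_eq h (mem_insert_of_mem hl)
  have hij : j ≠ i := by grind
  nth_rw 1 [← hi]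
  rw [minor_updateCol, ← colDet_update]
  exact colDet_eq_zero A fun hinj => hij (hinj (by simp [hij, hj]))

theorem abs_minor_updateCol_col (A : Matrix (Fin k) (Fin n) ℝ) {μ l : Fin n}
    {T : Finset (Fin n)} (hμ : μ ∉ T) (hT : T.card + 1 = k) (hl : l ∉ T) :
    |minor (A.updateCol μ (A.col l)) (insert μ T)| = |minor A (insert l T)| := by
  have h : (insert μ T).card = k := by rw [card_insert_of_notMem hμ, hT]
  obtain ⟨i, hi⟩ := exists_orderEmbOfFin_eq h (mem_insert_self μ T)
  set f := (insert μ T).orderEmbOfFin h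
  have hmem (j : Fin k) (hj : j ≠ i) : f j ∈ T :=
    (mem_insert.mp (orderEmbOfFin_mem _ h j)).resolve_left fun hμ =>
      hj (f.injective (hμ.trans hi.symm))
  have hinj : Function.Injective (Function.update f i l) := by
    intro j j' hjj'
    grind [f.injective]
  have himage : univ.image (Function.update f i l) = insert l T := by
    refine eq_of_subset_of_card_le ?_ ?_
    · grind
    · rw [card_image_of_injective _ hinj, card_insert_of_notMem hl, hT, card_fin]
  nth_rw 1 [← hi]
  rw [minor_updateCol, ← colDet_update, abs_colDet hinj, himage]

theorem exists_forall_apply_eq_of_triangular {K V : Type*} [Field K] [AddCommGroup V] [Module K V]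
    (φ : Fin k → V →ₗ[K] K) (e : Fin k → V) (hlt : ∀ p l, l < p → φ p (e l) = 0)
    (hdiag : ∀ p, φ p (e p) ≠ 0) (v : Fin k → K) : ∃ x, ∀ p, φ p x = v p := by
  let N : Matrix (Fin k) (Fin k) K := Matrix.of fun p l => φ p (e l)
  have hN : IsUnit N.det := by
    rw [Matrix.det_of_isUpperTriangular (M := N) fun p l h => hlt p l h, isUnit_iff_ne_zero]
    exact prod_ne_zero_iff.mpr fun p _ => hdiag p
  refine ⟨∑ l, N⁻¹.mulVec v l • e l, fun p => ?_⟩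
  calc φ p (∑ l, N⁻¹.mulVec v l • e l) = N.mulVec (N⁻¹.mulVec v) p := by
        simp [Matrix.mulVec, dotProduct, N, mul_comm]
    _ = v p := by rw [Matrix.mulVec_mulVec, Matrix.mul_nonsing_inv _ hN, Matrix.one_mulVec]

/-- The union of an initial segment and a final segment of the places below `μ`, with `p` and `q`
elements respectively. -/
def twoSegments (μ : Fin n) (p q : ℕ) : Finset (Fin n) :=
  univ.filter fun x => x.val < p ∨ μ.val - q ≤ x.val ∧ x < μ

theorem mem_twoSegments {μ x : Fin n} {p q : ℕ} :
    x ∈ twoSegments μ p q ↔ x.val < p ∨ μ.val - q ≤ x.val ∧ x < μ := by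
  simp [twoSegments]

theorem card_twoSegments {μ : Fin n} {p q : ℕ} (h : p + q ≤ μ.val) :
    (twoSegments μ p q).card = p + q := by
  let a : Fin n := ⟨p, by lia⟩
  let b : Fin n := ⟨μ.val - q, by lia⟩
  have : twoSegments μ p q = Iio a ∪ Ico b μ := by
    ext x
    simp only [mem_twoSegments, mem_union, mem_Iio, mem_Ico, Fin.lt_def, Fin.le_def, a, b]
  rw [this, card_union_of_disjoint, Fin.card_Iio, Fin.card_Ico]
  · simp only [a, b]
    lia
  · rw [disjoint_left]
    intro x
    simp only [mem_Iio, mem_Ico, Fin.lt_def, Fin.le_def, a, b]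
    lia

/-- The columns `0, …, k - 1` make the prescribed minors a triangular system. -/
theorem exists_minor_updateCol_twoSegments_eq {μ : Fin n} (hk : k ≤ μ)
    (A : Matrix (Fin k) (Fin n) ℝ)
    (hA : ∀ I : Finset (Fin n), I.card = k → I ⊆ Iio μ → minor A I ≠ 0) (v : Fin k → ℝ) :
    ∃ x, ∀ p : Fin k, minor (A.updateCol μ x) (insert μ (twoSegments μ p (k - 1 - p))) = v p := by
  let T (p : Fin k) : Finset (Fin n) := twoSegments μ p (k - 1 - p)
  have hT (p : Fin k) : (T p).card + 1 = k := by
    rw [card_twoSegments] <;> lia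
  have hμ (p : Fin k) : μ ∉ T p := by grind [mem_twoSegments]
  choose φ hφ using fun p => exists_linearMap_minor_updateCol A
    (by rw [card_insert_of_notMem (hμ p), hT p]) (mem_insert_self μ (T p))
  let e (l : Fin k) : Fin n := ⟨l, by lia⟩
  obtain ⟨x, hx⟩ := exists_forall_apply_eq_of_triangular φ (fun l => A.col (e l))
    (fun p l hlp => by
      rw [hφ]
      exact minor_updateCol_col_eq_zero A (hμ p) (hT p) (mem_twoSegments.mpr (Or.inl hlp)))
    (fun p => by
      have he : e p ∉ T p := by grind [mem_twoSegments]
      rw [hφ, ← abs_ne_zero, abs_minor_updateCol_col A (hμ p) (hT p) he, abs_ne_zero]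
      refine hA _ (by rw [card_insert_of_notMem he, hT p]) fun y hy => ?_
      grind [mem_twoSegments])
    v
  exact ⟨x, fun p => (hφ p x).symm.trans (hx p)⟩

end Columns

section Family

variable {n k : ℕ} {μ : Fin n} {T : Finset (Fin n)}

/-- The elements of `T` lying between two places outside `T` and below `μ`. -/
def innerPart (μ : Fin n) (T : Finset (Fin n)) : Finset (Fin n) :=
  T.filter fun b => (∃ a ∉ T, a < b) ∧ ∃ c ∉ T, b < c ∧ c < μ

theorem mem_innerPart {b : Fin n} :
    b ∈ innerPart μ T ↔ b ∈ T ∧ (∃ a ∉ T, a < b) ∧ ∃ c ∉ T, b < c ∧ c < μ := by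
  simp [innerPart]

theorem exists_outermost_gaps {b : Fin n} (hb : b ∈ innerPart μ T) :
    ∃ a ∉ T, ∃ c ∉ T, a < b ∧ b < c ∧ c < μ ∧ ∀ z ∉ T, a ≤ z ∧ (z < μ → z ≤ c) := by
  obtain ⟨-, ⟨a', ha', hab'⟩, c', hc', hbc', hcμ'⟩ := mem_innerPart.mp hb
  obtain ⟨a, ha, hmin⟩ := exists_min_image Tᶜ id ⟨a', by simpa⟩
  obtain ⟨c, hc, hmax⟩ := exists_max_image (Tᶜ.filter (· < μ)) id ⟨c', by simp [*]⟩
  simp only [mem_compl, mem_filter, id] at ha hmin hc hmax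
  exact ⟨a, ha, c, hc.1, (hmin a' ha').trans_lt hab', hbc'.trans_le (hmax c' ⟨hc', hcμ'⟩), hc.2,
    fun z hz => ⟨hmin z hz, fun h => hmax z ⟨hz, h⟩⟩⟩

theorem innerPart_exch_ssubset {a b c e : Fin n} (hb : b ∈ T) (ha : a ∉ T) (hc : c ∉ T)
    (hab : a < b) (hbc : b < c) (hcμ : c < μ)
    (hout : ∀ z ∉ T, a ≤ z ∧ (z < μ → z ≤ c)) (he : e ≤ a ∨ c ≤ e) :
    innerPart μ (exch T b e) ⊂ innerPart μ T := by
  have hbT : b ∈ innerPart μ T := mem_innerPart.mpr ⟨hb, ⟨a, ha, hab⟩, c, hc, hbc, hcμ⟩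
  refine (ssubset_iff_of_subset fun x hx => ?_).mpr ⟨b, hbT, by grind [mem_innerPart, mem_exch]⟩
  obtain ⟨hxT, ⟨a', ha', hax⟩, c', hc', hxc, hcμ'⟩ := mem_innerPart.mp hx
  have hax : a < x := by grind [mem_exch]
  have hxc : x < c := by grind [mem_exch]
  exact mem_innerPart.mpr ⟨by grind [mem_exch], ⟨a, ha, hax⟩, c, hc, hxc, hcμ⟩

theorem exists_eq_twoSegments (hk : k ≤ μ) (hTμ : T ⊆ Iio μ) (hT : T.card + 1 = k)
    (hinner : innerPart μ T = ∅) : ∃ p : Fin k, T = twoSegments μ p (k - 1 - p) := by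
  obtain ⟨p, hp, hmin⟩ := exists_min_image Tᶜ id ⟨μ, by grind [mem_compl]⟩
  simp only [mem_compl, id] at hp hmin
  have hIio : Iio p ⊆ T := fun x hx => by grind
  have hpk : p.val < k := by
    have := card_le_card hIio
    rw [Fin.card_Iio] at this
    lia
  refine ⟨⟨p, hpk⟩, eq_of_subset_of_card_le (fun b hb => mem_twoSegments.mpr ?_) ?_⟩
  · refine or_iff_not_imp_left.mpr fun hbp => ⟨?_, mem_Iio.mp (hTμ hb)⟩
    have hpb : p < b := by grind
    have hIco : Ico b μ ⊆ T := fun c hc => by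
      by_contra hcT
      have : b ∈ innerPart μ T := by grind [mem_innerPart]
      simp [hinner] at this
    have hdisj : Disjoint (Iio p) (Ico b μ) := disjoint_left.mpr fun z => by grind
    have := card_le_card (union_subset hIio hIco)
    rw [card_union_of_disjoint hdisj, Fin.card_Iio, Fin.card_Ico] at this
    lia
  · rw [card_twoSegments] <;> lia

/-- The minors of the family `A` on the columns `I` vanish to order `w I` at `0⁺`. -/
def Realizes (A : ℝ → Matrix (Fin k) (Fin n) ℝ) (w : Finset (Fin n) → ℕ) (I : Finset (Fin n)) :
    Prop :=
  HasOrder (fun t => minor (A t) I) (w I)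

variable {w : Finset (Fin n) → ℕ} {A : ℝ → Matrix (Fin k) (Fin n) ℝ}

theorem IsTropicalPositive.realizes_bd (hw : IsTropicalPositive k w) {S : Finset (Fin n)}
    {a b c d : Fin n} (hS : S.card + 2 = k) (hO : OrderedOutside S a b c d)
    (hab : Realizes A w (S ∪ {a, b})) (hcd : Realizes A w (S ∪ {c, d}))
    (had : Realizes A w (S ∪ {a, d})) (hbc : Realizes A w (S ∪ {b, c}))
    (hac : Realizes A w (S ∪ {a, c})) : Realizes A w (S ∪ {b, d}) := by
  have hsum := (hab.mul hcd).add (had.mul hbc)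
  rw [← hw hS hO, add_comm] at hsum
  refine (hsum.div hac).congr ?_
  filter_upwards [hac.1] with t ht
  rw [← minor_three_term (A t) hS hO, mul_div_cancel_left₀ _ ht.ne']

/-- Induction on the number of inner elements of `T`, by the three-term relation for `μ`, an inner
element and the outermost gaps of `T`. -/
theorem IsTropicalPositive.realizes_insert (hw : IsTropicalPositive k w) (hk : k ≤ μ)
    (hold : ∀ I : Finset (Fin n), I.card = k → I ⊆ Iio μ → Realizes A w I)
    (hseg : ∀ p : Fin k, Realizes A w (insert μ (twoSegments μ p (k - 1 - p))))
    (hT : T.card + 1 = k) (hTμ : T ⊆ Iio μ) : Realizes A w (insert μ T) := by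
  induction T using (measure fun T => (innerPart μ T).card).wf.induction with
  | _ T ih =>
  obtain hinner | ⟨b, hb⟩ := (innerPart μ T).eq_empty_or_nonempty
  · obtain ⟨p, rfl⟩ := exists_eq_twoSegments hk hTμ hT hinner
    exact hseg p
  obtain ⟨a, ha, c, hc, hab, hbc, hcμ, hout⟩ := exists_outermost_gaps hb
  have hbT := (mem_innerPart.mp hb).1
  set S := T.erase b
  have hS : S.card + 2 = k := by
    have := card_erase_add_one hbT
    lia
  have hO : OrderedOutside S a b c μ :=
    ⟨hab, hbc, hcμ, by grind, by grind, by grind, by grind⟩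
  have hpair {u v : Fin n} (huv : u < v) (hvμ : v < μ) (hu : u ∉ S) (hv : v ∉ S) :
      Realizes A w (S ∪ {u, v}) :=
    hold _ (by rw [card_union_pair huv.ne hu hv, hS]) fun z hz => by grind
  have hrec {e : Fin n} (he : e ∉ T) (heμ : e < μ) (heac : e ≤ a ∨ c ≤ e) :
      Realizes A w (S ∪ {e, μ}) := by
    have := ih (exch T b e) (card_lt_card (innerPart_exch_ssubset hbT ha hc hab hbc hcμ hout heac))
      (by rw [card_exch hbT he, hT]) fun z hz => by grind [mem_exch]
    rwa [show insert μ (exch T b e) = S ∪ {e, μ} by ext; grind [mem_exch]] at this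
  rw [show insert μ T = S ∪ {b, μ} by ext; grind]
  exact hw.realizes_bd hS hO (hpair hab (hbc.trans hcμ) hO.a_notMem hO.b_notMem)
    (hrec hc hcμ (Or.inr le_rfl)) (hrec ha (hab.trans (hbc.trans hcμ)) (Or.inl le_rfl))
    (hpair hbc hcμ hO.b_notMem hO.c_notMem) (hpair (hab.trans hbc) hcμ hO.a_notMem hO.c_notMem)

/-- The values of the new column at `μ` are prescribed on the two-segment minors only. -/
theorem IsTropicalPositive.exists_realizes_succ (hw : IsTropicalPositive k w) (hk : k ≤ μ)
    (hA : ∀ I : Finset (Fin n), I.card = k → I ⊆ Iio μ → Realizes A w I) :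
    ∃ A' : ℝ → Matrix (Fin k) (Fin n) ℝ,
      ∀ I : Finset (Fin n), I.card = k → I ⊆ Iic μ → Realizes A' w I := by
  let T (p : Fin k) : Finset (Fin n) := insert μ (twoSegments μ p (k - 1 - p))
  have hne : ∀ᶠ t in 𝓝[>] 0, ∀ I : Finset (Fin n), I.card = k → I ⊆ Iio μ → minor (A t) I ≠ 0 :=
    eventually_all.mpr fun I => eventually_imp_distrib_left.mpr fun hI =>
      eventually_imp_distrib_left.mpr fun hIμ => (hA I hI hIμ).1.mono fun _ ht => ht.ne'
  have hx : ∀ᶠ t in 𝓝[>] 0, ∃ x, ∀ p, minor ((A t).updateCol μ x) (T p) = t ^ w (T p) :=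
    hne.mono fun t ht => exists_minor_updateCol_twoSegments_eq hk (A t) ht _
  obtain ⟨x, hx⟩ := hx.choice
  have hold (I : Finset (Fin n)) (hI : I.card = k) (hIμ : I ⊆ Iio μ) :
      Realizes (fun t => (A t).updateCol μ (x t)) w I := by
    simpa only [Realizes, minor_updateCol_of_notMem _ (show μ ∉ I by grind)] using hA I hI hIμ
  have hseg (p : Fin k) : Realizes (fun t => (A t).updateCol μ (x t)) w (T p) :=
    (HasOrder.pow _).congr (hx.mono fun t ht => (ht p).symm)
  refine ⟨fun t => (A t).updateCol μ (x t), fun I hI hIμ => ?_⟩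
  by_cases hμI : μ ∈ I
  · rw [← insert_erase hμI]
    exact hw.realizes_insert hk hold hseg (by rw [card_erase_add_one hμI, hI]) fun z hz => by grind
  · exact hold I hI fun z hz => by grind

theorem exists_det_eq_pow {e : ℕ} (h : k = 0 → e = 0) :
    ∃ C : ℝ → Matrix (Fin k) (Fin k) ℝ, ∀ t, (C t).det = t ^ e := by
  cases k with
  | zero => exact ⟨fun _ => 1, by simp [h]⟩
  | succ k => exact ⟨fun t => Matrix.diagonal (Fin.cons (t ^ e) 1), by simp [Fin.prod_univ_succ]⟩

theorem IsTropicalPositive.exists_realizes (hw : IsTropicalPositive k w) {I₀ : Finset (Fin n)}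
    (hI₀ : I₀.card = k) (hw₀ : w I₀ = 0) :
    ∃ A : ℝ → Matrix (Fin k) (Fin n) ℝ, ∀ I : Finset (Fin n), I.card = k → Realizes A w I := by
  have hkn : k ≤ n := by simpa [hI₀] using card_le_univ I₀
  suffices H : ∀ m, k ≤ m → m ≤ n → ∃ A : ℝ → Matrix (Fin k) (Fin n) ℝ,
      ∀ I : Finset (Fin n), I.card = k → (∀ x ∈ I, x.val < m) → Realizes A w I by
    obtain ⟨A, hA⟩ := H n hkn le_rfl
    exact ⟨A, fun I hI => hA I hI fun x _ => x.isLt⟩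
  intro m hkm hmn
  induction m, hkm using Nat.le_induction with
  | base =>
    let J : Finset (Fin n) := univ.filter fun x => x.val < k
    have hJ : J.card = k := by simpa [J, Fin.card_filter_val_lt] using hkn
    obtain ⟨C, hC⟩ := exists_det_eq_pow (k := k) (e := w J) (by
      rintro rfl
      rwa [card_eq_zero.mp hJ, ← card_eq_zero.mp hI₀])
    refine ⟨fun t => C t * vander k n, fun I hI hlt => ?_⟩
    obtain rfl : I = J := eq_of_subset_of_card_le (fun x hx => by simp [J, hlt x hx]) (by lia)
    simpa only [Realizes, minor_mul_left, hC] using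
      (HasOrder.pow (w J)).mul_const (minor_vander_pos hJ)
  | succ m hkm ih =>
    obtain ⟨A, hA⟩ := ih (by lia)
    obtain ⟨A', hA'⟩ := hw.exists_realizes_succ (μ := ⟨m, hmn⟩) hkm fun I hI hIm =>
      hA I hI fun x hx => Fin.lt_def.mp (mem_Iio.mp (hIm hx))
    exact ⟨A', fun I hI hlt => hA' I hI fun x hx =>
      mem_Iic.mpr (Fin.le_def.mpr (Nat.le_of_lt_succ (hlt x hx)))⟩

end Family

/-! ### Positroids and the positive three-term condition -/

section Positroids

variable {n k : ℕ}

theorem entry_eq_colDet (B : Matrix (Fin k) (Fin n) ℝ) {f : Fin k → Fin n}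
    (hf : B.submatrix id f = 1) (r : Fin k) (j : Fin n) :
    B r j = colDet B (Function.update f r j) := by
  rw [colDet_update, hf, ← Matrix.cramer_apply, Matrix.cramer_one]
  rfl

theorem continuous_minor (I : Finset (Fin n)) :
    Continuous fun B : Fin k → Fin n → ℝ => minor (Matrix.of B) I := by
  by_cases h : I.card = k
  · simp only [minor_eq _ h, colDet]
    exact Continuous.matrix_det (by fun_prop)
  · simpa only [minor, dif_neg h] using continuous_const

variable {w : Finset (Fin n) → ℕ} {A : ℝ → Matrix (Fin k) (Fin n) ℝ}

theorem exists_realizes_submatrix_eq_one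
    (hA : ∀ I : Finset (Fin n), I.card = k → Realizes A w I) {I₀ : Finset (Fin n)}
    (hI₀ : I₀.card = k) (hw₀ : w I₀ = 0) :
    ∃ B : ℝ → Matrix (Fin k) (Fin n) ℝ,
      (∀ I : Finset (Fin n), I.card = k → Realizes B w I) ∧
      ∀ᶠ t in 𝓝[>] 0, (B t).submatrix id (I₀.orderEmbOfFin hI₀) = 1 := by
  let C (t : ℝ) := (A t).submatrix id (I₀.orderEmbOfFin hI₀)
  have hC (t : ℝ) : (C t).det = minor (A t) I₀ := (minor_eq _ hI₀).symm
  refine ⟨fun t => (C t)⁻¹ * A t, fun I hI => ?_, ?_⟩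
  · have hdiv : HasOrder (fun t => minor (A t) I / minor (A t) I₀) (w I) :=
      HasOrder.div (b := 0) (hA I hI) (hw₀ ▸ hA I₀ hI₀)
    refine hdiv.congr (.of_forall fun t => ?_)
    simp only [minor_mul_left, Matrix.det_nonsing_inv, hC, Ring.inverse_eq_inv', div_eq_inv_mul]
  · filter_upwards [(hA I₀ hI₀).1] with t ht
    exact Matrix.nonsing_inv_mul (C t) (by rw [hC]; exact ht.ne'.isUnit)

/-- The entries of a matrix containing an identity block are maximal minors up to sign. -/
theorem isBigO_one_of_submatrix_eq_one
    (hA : ∀ I : Finset (Fin n), I.card = k → Realizes A w I) {f : Fin k → Fin n}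
    (hf : ∀ᶠ t in 𝓝[>] 0, (A t).submatrix id f = 1) :
    (fun t r j => A t r j : ℝ → Fin k → Fin n → ℝ) =O[𝓝[>] 0] fun _ => (1 : ℝ) := by
  simp only [isBigO_pi]
  intro r j
  have hentry : (fun t => A t r j) =ᶠ[𝓝[>] 0] fun t => colDet (A t) (Function.update f r j) :=
    hf.mono fun t ht => entry_eq_colDet (A t) ht r j
  suffices (fun t => colDet (A t) (Function.update f r j)) =O[𝓝[>] 0] fun _ => (1 : ℝ) from
    hentry.trans_isBigO this
  by_cases hg : Function.Injective (Function.update f r j)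
  · have hcard : (univ.image (Function.update f r j)).card = k := by
      rw [card_image_of_injective _ hg, card_fin]
    exact (isBigO_of_le (g := fun t => minor (A t) (univ.image (Function.update f r j))) _
      fun t => (abs_colDet hg (A t)).le).trans (hA _ hcard).isBigO_one
  · simpa only [colDet_eq_zero _ hg] using isBigO_zero _ _

theorem exists_ultrafilter_tendsto {α E : Type*} [NormedAddCommGroup E] [ProperSpace E]
    {l : Filter α} [l.NeBot] {f : α → E} (hf : f =O[l] fun _ => (1 : ℝ)) :
    ∃ U : Ultrafilter α, ↑U ≤ l ∧ ∃ x, Tendsto f U (𝓝 x) := by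
  obtain ⟨K, hK⟩ := hf.bound
  have hmem : ∀ᶠ t in (Ultrafilter.of l : Filter α), f t ∈ Metric.closedBall 0 K :=
    Ultrafilter.of_le l (hK.mono fun t ht => by simpa using ht)
  obtain ⟨x, -, hx⟩ := (isCompact_closedBall (0 : E) K).ultrafilter_le_nhds
    ((Ultrafilter.of l).map f) (le_principal_iff.mpr hmem)
  exact ⟨Ultrafilter.of l, Ultrafilter.of_le l, x, hx⟩

theorem IsTropicalPositive.exists_matrix (hw : IsTropicalPositive k w) {I₀ : Finset (Fin n)}
    (hI₀ : I₀.card = k) (hw₀ : w I₀ = 0) :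
    ∃ B : Matrix (Fin k) (Fin n) ℝ, ∀ I : Finset (Fin n), I.card = k →
      0 ≤ minor B I ∧ (minor B I ≠ 0 ↔ w I = 0) := by
  obtain ⟨A, hA⟩ := hw.exists_realizes hI₀ hw₀
  obtain ⟨B, hB, hone⟩ := exists_realizes_submatrix_eq_one hA hI₀ hw₀
  obtain ⟨U, hU, L, hL⟩ :=
    exists_ultrafilter_tendsto (isBigO_one_of_submatrix_eq_one hB hone)
  exact ⟨Matrix.of L, fun I hI => (hB I hI).nonneg_and_ne_zero_iff_of_tendsto hU
    (((continuous_minor I).tendsto L).comp hL)⟩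

theorem PosThreeTerm.isPositroid {M : Matroid (Fin n)} (hM : PosThreeTerm M)
    (hE : M.E = Set.univ) : IsPositroid M := by
  obtain ⟨I₀, hI₀⟩ := M.exists_isBase
  lift I₀ to Finset (Fin n) using Set.toFinite I₀
  have hk : M.eRank = I₀.card := by
    rw [← hI₀.encard_eq_eRank, Set.encard_coe_eq_coe_finsetCard]
  obtain ⟨w, hw, hwM⟩ := hM.exists_isTropicalPositive hE hk
  obtain ⟨B, hB⟩ := hw.exists_matrix rfl ((hwM I₀).mpr hI₀)
  have hplucker (I : Finset (Fin n)) (hI : I.card = I₀.card) : plucker B I hI = minor B I :=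
    (minor_eq B hI).symm
  refine ⟨hE, I₀.card, B, fun I hI => hplucker I hI ▸ (hB I hI).1, fun I => ⟨fun h => ?_, ?_⟩⟩
  · have hI := card_eq_of_isBase hk h
    exact ⟨hI, hplucker I hI ▸ (hB I hI).2.mpr ((hwM I).mpr h)⟩
  · rintro ⟨hI, h⟩
    exact (hwM I).mp ((hB I hI).2.mp (hplucker I hI ▸ h))

theorem IsPositroid.exists_isBase_iff_minor_pos {M : Matroid (Fin n)} (hM : IsPositroid M) :
    ∃ (k : ℕ) (A : Matrix (Fin k) (Fin n) ℝ), M.eRank = k ∧ (∀ I, 0 ≤ minor A I) ∧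
      ∀ I : Finset (Fin n), M.IsBase ↑I ↔ 0 < minor A I := by
  obtain ⟨-, k, A, hA, hbase⟩ := hM
  have hnonneg (I : Finset (Fin n)) : 0 ≤ minor A I := by
    unfold minor
    split_ifs with h
    exacts [hA I h, le_rfl]
  obtain ⟨B, hB⟩ := M.exists_isBase
  lift B to Finset (Fin n) using Set.toFinite B
  refine ⟨k, A, ?_, hnonneg, fun I => ?_⟩
  · rw [← hB.encard_eq_eRank, Set.encard_coe_eq_coe_finsetCard, ((hbase B).mp hB).1]
  · rw [hbase, (hnonneg I).lt_iff_ne']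
    by_cases h : I.card = k <;> simp [minor, h]

theorem IsPositroid.posThreeTerm {M : Matroid (Fin n)} (hM : IsPositroid M) : PosThreeTerm M := by
  obtain ⟨k, A, hk, hnonneg, hbase⟩ := hM.exists_isBase_iff_minor_pos
  intro S a b c d hO h
  have hS : S.card + 2 = k := by
    rcases h with h | h
    · rw [← card_union_pair hO.lt_ab.ne hO.a_notMem hO.b_notMem, card_eq_of_isBase hk h.1]
    · rw [← card_union_pair hO.lt_bc.ne hO.b_notMem hO.c_notMem, card_eq_of_isBase hk h.2]
  simp only [hbase] at h ⊢
  have hpos : 0 < minor A (S ∪ {a, c}) * minor A (S ∪ {b, d}) := by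
    rw [minor_three_term A hS hO]
    rcases h with h | h
    · exact add_pos_of_pos_of_nonneg (mul_pos h.1 h.2) (mul_nonneg (hnonneg _) (hnonneg _))
    · exact add_pos_of_nonneg_of_pos (mul_nonneg (hnonneg _) (hnonneg _)) (mul_pos h.1 h.2)
  exact ⟨pos_of_mul_pos_left hpos (hnonneg _), pos_of_mul_pos_right hpos (hnonneg _)⟩

end Positroids

/-! ### Faces of matroid polytopes -/

section Polytopes

theorem toExposed_convexHull {E : Type*} [AddCommGroup E] [Module ℝ E] [TopologicalSpace E]
    [IsTopologicalAddGroup E] [ContinuousSMul ℝ E] [LocallyConvexSpace ℝ E] [T2Space E]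
    {V : Set E} (hV : V.Finite) (l : StrongDual ℝ E) :
    l.toExposed (convexHull ℝ V) = convexHull ℝ (l.toExposed V) := by
  have hF : IsExposed ℝ (convexHull ℝ V) (l.toExposed (convexHull ℝ V)) :=
    ContinuousLinearMap.toExposed.isExposed
  have hconvex := hF.convex (convex_convexHull ℝ V)
  refine Set.Subset.antisymm ?_ (convexHull_min (fun v hv => ?_) hconvex)
  · rw [← closure_convexHull_extremePoints (hF.isCompact (hV.isCompact_convexHull ℝ)) hconvex]
    refine closure_minimal (convexHull_mono fun x hx => ?_)
      ((hV.subset fun v hv => hv.1).isClosed_convexHull ℝ)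
    exact ⟨extremePoints_convexHull_subset (hF.isExtreme.extremePoints_subset_extremePoints hx),
      fun y hy => hx.1.2 y (subset_convexHull ℝ V hy)⟩
  · exact ⟨subset_convexHull ℝ V hv.1,
      convexHull_min hv.2 (convex_halfSpace_le l.toLinearMap.isLinear (l v))⟩

variable {n : ℕ} {M N : Matroid (Fin n)} {l : StrongDual ℝ (Fin n → ℝ)}

theorem indVec_apply (B : Set (Fin n)) (i : Fin n) [Decidable (i ∈ B)] :
    indVec B i = if i ∈ B then 1 else 0 := by
  simp [indVec, Set.indicator_apply]

theorem indVec_injective : Function.Injective (indVec : Set (Fin n) → Fin n → ℝ) :=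
  fun _ _ h => Set.indicator_one_inj ℝ h

theorem extremePoints_convexHull_indVec (𝓑 : Set (Set (Fin n))) :
    (convexHull ℝ (indVec '' 𝓑)).extremePoints ℝ = indVec '' 𝓑 := by
  classical
  have hcube : convexHull ℝ (indVec '' 𝓑) ⊆ Set.univ.pi fun _ => Set.Icc 0 1 := by
    refine convexHull_min ?_ (convex_pi fun _ _ => convex_Icc 0 1)
    rintro _ ⟨B, -, rfl⟩ i -
    rw [indVec_apply]
    split_ifs <;> simp
  refine extremePoints_convexHull_subset.antisymm fun v hv => ?_
  refine inter_extremePoints_subset_extremePoints_of_subset hcube ⟨subset_convexHull ℝ _ hv, ?_⟩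
  obtain ⟨B, -, rfl⟩ := hv
  simp only [extremePoints_pi, Set.extremePoints_Icc zero_le_one, Set.mem_univ_pi, indVec_apply]
  grind

theorem eq_of_matroidPolytope_eq (hM : M.E = Set.univ) (hN : N.E = Set.univ)
    (h : matroidPolytope M = matroidPolytope N) : M = N := by
  have hbases := congrArg (Set.extremePoints ℝ) h
  simp only [matroidPolytope, extremePoints_convexHull_indVec] at hbases
  exact Matroid.ext_isBase (hM.trans hN.symm) fun B _ =>
    Set.ext_iff.mp (indVec_injective.image_injective hbases) B

/-- `B` is a basis of `M` maximizing the functional `l`. -/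
def IsMaxBase (M : Matroid (Fin n)) (l : StrongDual ℝ (Fin n → ℝ)) (B : Set (Fin n)) : Prop :=
  M.IsBase B ∧ ∀ B', M.IsBase B' → l (indVec B') ≤ l (indVec B)

theorem toExposed_matroidPolytope (M : Matroid (Fin n)) (l : StrongDual ℝ (Fin n → ℝ)) :
    l.toExposed (matroidPolytope M) = convexHull ℝ (indVec '' {B | IsMaxBase M l B}) := by
  rw [matroidPolytope, toExposed_convexHull (Set.toFinite _)]
  congr 1
  ext v
  simp only [ContinuousLinearMap.toExposed, IsMaxBase, Set.mem_image, Set.mem_ofPred_eq]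
  grind

theorem exists_isMaxBase (M : Matroid (Fin n)) (l : StrongDual ℝ (Fin n → ℝ)) :
    ∃ B, IsMaxBase M l B := by
  obtain ⟨B, hB, hmax⟩ := (Set.toFinite {B | M.IsBase B}).exists_maximalFor
    (fun B => l (indVec B)) _ M.exists_isBase
  exact ⟨B, hB, fun B' hB' => le_of_not_gt fun h => h.not_ge (hmax hB' h.le)⟩

theorem IsMaxBase.of_add_eq_add {A B C D : Set (Fin n)} (hA : IsMaxBase M l A)
    (hB : IsMaxBase M l B) (hC : M.IsBase C) (hD : M.IsBase D)
    (h : indVec C + indVec D = indVec A + indVec B) : IsMaxBase M l C ∧ IsMaxBase M l D := by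
  have hl := congrArg l h
  rw [map_add, map_add] at hl
  have := hB.2 C hC
  have := hB.2 D hD
  have := hA.2 B hB.1
  have := hB.2 A hA.1
  exact ⟨⟨hC, fun B' hB' => by linarith [hB.2 B' hB']⟩,
    hD, fun B' hB' => by linarith [hB.2 B' hB']⟩

theorem indVec_exchange {A B : Set (Fin n)} {x y : Fin n} (hxA : x ∈ A) (hxB : x ∉ B)
    (hyB : y ∈ B) (hyA : y ∉ A) :
    indVec (insert y (A \ {x})) + indVec (insert x (B \ {y})) = indVec A + indVec B := by
  classical
  ext i
  simp only [Pi.add_apply, indVec_apply, Set.mem_insert_iff, Set.mem_sdiff, Set.mem_singleton_iff]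
  grind

/-- The matroid whose bases are the bases of `M` on which `l` is maximal. -/
def faceMatroid (M : Matroid (Fin n)) (l : StrongDual ℝ (Fin n → ℝ)) : Matroid (Fin n) :=
  Matroid.ofIsBaseOfFinite Set.finite_univ (IsMaxBase M l) (exists_isMaxBase M l)
    (fun A B hA hB x ⟨hxA, hxB⟩ => by
      obtain ⟨y, hyB, hyA, hA', hB'⟩ := isBase_symm_exchange hA.1 hB.1 hxA hxB
      exact ⟨y, ⟨hyB, hyA⟩, (hA.of_add_eq_add hB hA' hB' (indVec_exchange hxA hxB hyB hyA)).1⟩)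
    fun _ _ => Set.subset_univ _

theorem faceMatroid_isBase {B : Set (Fin n)} : (faceMatroid M l).IsBase B ↔ IsMaxBase M l B :=
  Iff.rfl

theorem indVec_union_pair {S : Finset (Fin n)} {x y : Fin n} (hxy : x ≠ y) (hx : x ∉ S)
    (hy : y ∉ S) : indVec ↑(S ∪ {x, y}) = indVec ↑S + Pi.single x 1 + Pi.single y 1 := by
  ext i
  simp only [Pi.add_apply, Pi.single_apply, indVec_apply, mem_coe]
  grind

theorem PosThreeTerm.faceMatroid (hM : PosThreeTerm M) (l : StrongDual ℝ (Fin n → ℝ)) :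
    PosThreeTerm (faceMatroid M l) := by
  intro S a b c d hO h
  obtain ⟨hab, hbc, hcd, ha, hb, hc, hd⟩ := id hO
  simp only [faceMatroid_isBase] at h ⊢
  obtain ⟨hac, hbd⟩ := hM hO (h.imp (fun h => ⟨h.1.1, h.2.1⟩) fun h => ⟨h.1.1, h.2.1⟩)
  rcases h with ⟨h₁, h₂⟩ | ⟨h₁, h₂⟩ <;> refine h₁.of_add_eq_add h₂ hac hbd ?_ <;>
  · simp only [indVec_union_pair, hab.ne, hbc.ne, hcd.ne, (hab.trans hbc).ne, (hbc.trans hcd).ne,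
      (hab.trans (hbc.trans hcd)).ne, ha, hb, hc, hd, ne_eq, not_false_eq_true]
    abel

theorem IsPositroid.isPositroidPolytope_of_isExposed (hM : IsPositroid M) {F : Set (Fin n → ℝ)}
    (hne : F.Nonempty) (hF : IsExposed ℝ (matroidPolytope M) F) : IsPositroidPolytope F := by
  obtain ⟨l, rfl⟩ := hF hne
  exact ⟨faceMatroid M l, (hM.posThreeTerm.faceMatroid l).isPositroid rfl,
    toExposed_matroidPolytope M l⟩

end Polytopes

/-! ### Square faces -/

section Square

variable {n k : ℕ} {M : Matroid (Fin n)} {S T U B : Finset (Fin n)} {a b c d : Fin n}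

/-- The sets `S + x + y` with `x ∈ T` and `y ∈ U`. -/
def squareBases (S T U : Finset (Fin n)) : Set (Set (Fin n)) :=
  Set.image2 (fun x y => ↑(S ∪ {x, y})) T U

theorem squareBases_swap (S T U : Finset (Fin n)) : squareBases S U T = squareBases S T U := by
  rw [squareBases, Set.image2_swap]
  simp only [pair_comm, squareBases]

theorem image_indVec_squareBases (S : Finset (Fin n)) (a b c d : Fin n) :
    indVec '' squareBases S {a, c} {b, d} = {indVec (↑S ∪ {a, b}), indVec (↑S ∪ {a, d}),
      indVec (↑S ∪ {b, c}), indVec (↑S ∪ {c, d})} := by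
  rw [Set.pair_comm b c, squareBases, Set.image_image2]
  ext v
  simp only [coe_union, coe_pair, Set.image2_insert_left, Set.image2_singleton_left,
    Set.image_insert_eq, Set.image_singleton, Set.mem_union, Set.mem_insert_iff,
    Set.mem_singleton_iff]
  tauto

/-- The sets `squareBases S T U` are the vertices of a square with diagonals `T` and `U`. -/
structure IsSquare (S T U : Finset (Fin n)) : Prop where
  card_left : T.card = 2
  card_right : U.card = 2
  left_disjoint : Disjoint S T
  right_disjoint : Disjoint S U
  disjoint : Disjoint T U

theorem IsSquare.symm (h : IsSquare S T U) : IsSquare S U T :=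
  ⟨h.card_right, h.card_left, h.right_disjoint, h.left_disjoint, h.disjoint.symm⟩

theorem IsSquare.exists_mem_squareBases (h : IsSquare S T U) :
    ∃ B : Finset (Fin n), ↑B ∈ squareBases S T U := by
  obtain ⟨x, hx⟩ : T.Nonempty := card_pos.mp (by simp [h.card_left])
  obtain ⟨y, hy⟩ : U.Nonempty := card_pos.mp (by simp [h.card_right])
  exact ⟨S ∪ {x, y}, x, hx, y, hy, rfl⟩

theorem OrderedOutside.isSquare (h : OrderedOutside S a b c d) : IsSquare S {a, c} {b, d} := by
  obtain ⟨hab, hbc, hcd, ha, hb, hc, hd⟩ := h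
  exact ⟨card_pair (hab.trans hbc).ne, card_pair (hbc.trans hcd).ne, by simp [ha, hc],
    by simp [hb, hd], by simp [hab.ne', hbc.ne, hcd.ne', (hab.trans (hbc.trans hcd)).ne']⟩

theorem finrank_vectorSpan_parallelogram {K V : Type*} [DivisionRing K] [AddCommGroup V]
    [Module K V] {u v : V} (p : V) (h : LinearIndependent K ![u, v]) :
    Module.finrank K (vectorSpan K {p, p + u, p + v, p + u + v}) = 2 := by
  have hspan : vectorSpan K {p, p + u, p + v, p + u + v} = Submodule.span K {u, v} := by
    have hu : u ∈ Submodule.span K {u, v} := Submodule.subset_span (by simp)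
    have hv : v ∈ Submodule.span K {u, v} := Submodule.subset_span (by simp)
    rw [vectorSpan_eq_span_vsub_set_right K (Set.mem_insert p _)]
    simp only [Set.image_insert_eq, Set.image_singleton, vsub_eq_sub, sub_self, add_sub_cancel_left,
      add_assoc]
    refine le_antisymm (Submodule.span_le.mpr ?_) (Submodule.span_mono ?_)
    · rintro _ (rfl | rfl | rfl | rfl)
      exacts [zero_mem _, hu, hv, add_mem hu hv]
    · rintro _ (rfl | rfl) <;> simp
  rw [hspan, ← Matrix.range_cons_cons_empty u v ![], finrank_span_eq_card h, Fintype.card_fin]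

theorem IsSquare.finrank_vectorSpan (h : IsSquare S T U) :
    Module.finrank ℝ (vectorSpan ℝ (indVec '' squareBases S T U)) = 2 := by
  obtain ⟨a, c, hac, rfl⟩ := card_eq_two.mp h.card_left
  obtain ⟨b, d, hbd, rfl⟩ := card_eq_two.mp h.card_right
  let e (i : Fin n) : Fin n → ℝ := Pi.single i 1
  let p := indVec ↑S + e a + e b
  have hvert : indVec '' squareBases S {a, c} {b, d} =
      {p, p + (e c - e a), p + (e d - e b), p + (e c - e a) + (e d - e b)} := by
    have hvec {x y} (hx : x ∈ ({a, c} : Finset (Fin n))) (hy : y ∈ ({b, d} : Finset (Fin n))) :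
        indVec ↑(S ∪ {x, y}) = p + (e x - e a) + (e y - e b) := by
      rw [indVec_union_pair (disjoint_iff_ne.mp h.disjoint x hx y hy)
        (disjoint_right.mp h.left_disjoint hx) (disjoint_right.mp h.right_disjoint hy)]
      simp only [p, e]
      abel
    ext v
    rw [squareBases, Set.image_image2, Set.image2_congr fun _ hx _ hy => hvec hx hy]
    simp only [coe_pair, Set.image2_insert_left, Set.image2_singleton_left, Set.image_insert_eq,
      Set.image_singleton, Set.mem_union, Set.mem_insert_iff, Set.mem_singleton_iff, sub_self,
      add_zero]
    tauto
  have hindep : LinearIndependent ℝ ![e c - e a, e d - e b] := by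
    rw [LinearIndependent.pair_iff]
    intro s t hst
    have hcb : c ≠ b := disjoint_iff_ne.mp h.disjoint c (by simp) b (by simp)
    have hcd : c ≠ d := disjoint_iff_ne.mp h.disjoint c (by simp) d (by simp)
    have had : a ≠ d := disjoint_iff_ne.mp h.disjoint a (by simp) d (by simp)
    constructor
    · simpa [e, Pi.single_apply, hcb, hcd, hac.symm] using congrFun hst c
    · simpa [e, Pi.single_apply, hcd.symm, had.symm, hbd.symm] using congrFun hst d
  rw [hvert, finrank_vectorSpan_parallelogram p hindep]

/-- Maximizing this weight over the bases of a matroid of rank `|S| + 2` that do not contain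
`S ∪ T` forces the basis to contain `S` and one element of each of `T` and `U`. -/
def squareWeight (S T U : Finset (Fin n)) (i : Fin n) : ℕ :=
  (if i ∈ S then 3 else 0) + (if i ∈ T then 2 else 0) + if i ∈ U then 1 else 0

theorem sum_squareWeight (S T U B : Finset (Fin n)) :
    ∑ i ∈ B, squareWeight S T U i = 3 * (B ∩ S).card + 2 * (B ∩ T).card + (B ∩ U).card := by
  simp only [squareWeight, sum_add_distrib, sum_ite_mem, sum_const, smul_eq_mul, mul_comm, mul_one]

theorem IsSquare.sum_squareWeight_eq (h : IsSquare S T U) (hB : ↑B ∈ squareBases S T U) :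
    ∑ i ∈ B, squareWeight S T U i = 3 * S.card + 3 := by
  obtain ⟨x, hx, y, hy, hxy⟩ := hB
  have hdS := disjoint_left.mp h.left_disjoint
  have hdU := disjoint_left.mp h.right_disjoint
  have hd := disjoint_left.mp h.disjoint
  rw [mem_coe] at hx hy
  rw [sum_squareWeight, ← coe_inj.mp hxy,
    show (S ∪ {x, y}) ∩ S = S by grind, show (S ∪ {x, y}) ∩ T = {x} by grind,
    show (S ∪ {x, y}) ∩ U = {y} by grind, card_singleton, card_singleton]

theorem IsSquare.card_inter_add_le (h : IsSquare S T U) (B : Finset (Fin n)) :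
    (B ∩ S).card + (B ∩ T).card + (B ∩ U).card ≤ B.card := by
  have hST := h.left_disjoint.mono (inter_subset_right (s₁ := B)) (inter_subset_right (s₁ := B))
  have hU : Disjoint (B ∩ S ∪ B ∩ T) (B ∩ U) := disjoint_union_left.mpr
    ⟨h.right_disjoint.mono inter_subset_right inter_subset_right,
      h.disjoint.mono inter_subset_right inter_subset_right⟩
  rw [← card_union_of_disjoint hST, ← card_union_of_disjoint hU]
  exact card_le_card (by grind)

theorem eq_union_of_card_le (hB : B.card ≤ S.card + T.card) (hST : Disjoint S T)
    (hS : S.card ≤ (B ∩ S).card) (hT : T.card ≤ (B ∩ T).card) : B = S ∪ T := by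
  have hSB := inter_eq_right.mp (eq_of_subset_of_card_le inter_subset_right hS)
  have hTB := inter_eq_right.mp (eq_of_subset_of_card_le inter_subset_right hT)
  exact (eq_of_subset_of_card_le (union_subset hSB hTB)
    (hB.trans (card_union_of_disjoint hST).ge)).symm

theorem IsSquare.mem_squareBases (h : IsSquare S T U) (hB : B.card = S.card + 2)
    (hS : S.card ≤ (B ∩ S).card) (hT : (B ∩ T).Nonempty) (hU : (B ∩ U).Nonempty) :
    ↑B ∈ squareBases S T U := by
  obtain ⟨x, hx⟩ := hT
  obtain ⟨y, hy⟩ := hU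
  rw [mem_inter] at hx hy
  have hxS := disjoint_right.mp h.left_disjoint hx.2
  have hyS := disjoint_right.mp h.right_disjoint hy.2
  have hSB := inter_eq_right.mp (eq_of_subset_of_card_le inter_subset_right hS)
  have hxy := disjoint_iff_ne.mp h.disjoint x hx.2 y hy.2
  refine ⟨x, hx.2, y, hy.2, coe_inj.mpr (eq_of_subset_of_card_le ?_ ?_)⟩
  · grind
  · rw [hB, card_union_pair hxy hxS hyS]

theorem IsSquare.sum_squareWeight_le (h : IsSquare S T U) (hB : B.card = S.card + 2)
    (hne : B ≠ S ∪ T) :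
    ∑ i ∈ B, squareWeight S T U i ≤ 3 * S.card + 3 ∧
      (∑ i ∈ B, squareWeight S T U i = 3 * S.card + 3 → ↑B ∈ squareBases S T U) := by
  have hcard := h.card_inter_add_le B
  have hS := card_le_card (inter_subset_right : B ∩ S ⊆ S)
  have hT := card_le_card (inter_subset_right : B ∩ T ⊆ T)
  have hU := card_le_card (inter_subset_right : B ∩ U ⊆ U)
  have hST : (B ∩ S).card < S.card ∨ (B ∩ T).card < T.card := by
    contrapose! hne
    exact eq_union_of_card_le (by rw [hB, h.card_left]) h.left_disjoint hne.1 hne.2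
  rw [h.card_left] at hT hST
  rw [h.card_right] at hU
  rw [sum_squareWeight]
  refine ⟨by lia, fun heq => h.mem_squareBases hB (by lia) ?_ ?_⟩ <;>
    exact card_pos.mp (by lia)

theorem exists_dual_apply_indVec (f : Fin n → ℝ) :
    ∃ l : StrongDual ℝ (Fin n → ℝ), ∀ B : Finset (Fin n), l (indVec ↑B) = ∑ i ∈ B, f i := by
  refine ⟨∑ i, f i • ContinuousLinearMap.proj (R := ℝ) (φ := fun _ : Fin n => ℝ) i, fun B => ?_⟩
  simp [indVec_apply]

theorem IsSquare.exists_isMaxBase_iff (h : IsSquare S T U) (hk : M.eRank = (S.card + 2 : ℕ))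
    (hsides : ∀ B ∈ squareBases S T U, M.IsBase B) (hT : ¬ M.IsBase ↑(S ∪ T)) :
    ∃ l, ∀ B, IsMaxBase M l B ↔ B ∈ squareBases S T U := by
  obtain ⟨l, hl⟩ := exists_dual_apply_indVec fun i => (squareWeight S T U i : ℝ)
  simp only [← Nat.cast_sum] at hl
  have hle (B : Finset (Fin n)) (hB : M.IsBase B) :=
    h.sum_squareWeight_le (card_eq_of_isBase hk hB) fun h => hT (h ▸ hB)
  refine ⟨l, fun B => ?_⟩
  constructor
  · intro hB
    lift B to Finset (Fin n) using Set.toFinite B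
    obtain ⟨B', hB'⟩ := h.exists_mem_squareBases
    have hmax := hB.2 _ (hsides _ hB')
    rw [hl, hl, h.sum_squareWeight_eq hB', Nat.cast_le] at hmax
    exact (hle B hB.1).2 ((hle B hB.1).1.antisymm hmax)
  · intro hB
    refine ⟨hsides B hB, fun B' hB' => ?_⟩
    lift B to Finset (Fin n) using Set.toFinite B
    lift B' to Finset (Fin n) using Set.toFinite B'
    rw [hl, hl, h.sum_squareWeight_eq hB, Nat.cast_le]
    exact (hle B' hB').1

theorem IsSquare.isTwoFace (h : IsSquare S T U) (hk : M.eRank = (S.card + 2 : ℕ))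
    (hsides : ∀ B ∈ squareBases S T U, M.IsBase B) (hT : ¬ M.IsBase ↑(S ∪ T)) :
    IsTwoFace (matroidPolytope M) (convexHull ℝ (indVec '' squareBases S T U)) := by
  obtain ⟨l, hl⟩ := h.exists_isMaxBase_iff hk hsides hT
  have hface : convexHull ℝ (indVec '' squareBases S T U) = l.toExposed (matroidPolytope M) := by
    rw [toExposed_matroidPolytope]
    congr 2
    ext B
    exact (hl B).symm
  refine ⟨?_, hface ▸ ContinuousLinearMap.toExposed.isExposed, ?_⟩
  · obtain ⟨B, hB⟩ := exists_isMaxBase M l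
    exact ⟨_, subset_convexHull ℝ _ ⟨B, (hl B).mp hB, rfl⟩⟩
  · rw [← direction_affineSpan, affineSpan_convexHull, direction_affineSpan, h.finrank_vectorSpan]

theorem isBase_union_pair_exchange {x y z w : Fin n}
    (h₁ : M.IsBase ↑(S ∪ {x, y})) (h₂ : M.IsBase ↑(S ∪ {z, w}))
    (hx : x ∉ S ∪ {y, z, w}) (hz : z ∉ insert w S) (hw : w ∉ S) :
    (M.IsBase ↑(S ∪ {z, y}) ∧ M.IsBase ↑(S ∪ {x, w})) ∨
      (M.IsBase ↑(S ∪ {w, y}) ∧ M.IsBase ↑(S ∪ {x, z})) := by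
  obtain ⟨t, ht, htI, e₁, e₂⟩ := isBase_symm_exch h₁ h₂ (x := x) (by simp) (by grind)
  obtain rfl | rfl : t = z ∨ t = w := by grind
  · left
    constructor
    · convert e₁ using 2; grind [mem_exch]
    · convert e₂ using 2; grind [mem_exch]
  · right
    constructor
    · convert e₁ using 2; grind [mem_exch]
    · convert e₂ using 2; grind [mem_exch]

theorem exists_square_of_not_posThreeTerm (hM : ¬ PosThreeTerm M) :
    ∃ S a b c d, OrderedOutside S a b c d ∧
      (∀ B ∈ squareBases S {a, c} {b, d}, M.IsBase B) ∧
      ¬ (M.IsBase ↑(S ∪ {a, c}) ∧ M.IsBase ↑(S ∪ {b, d})) := by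
  unfold PosThreeTerm at hM
  push Not at hM
  obtain ⟨S, a, b, c, d, hO, hor, hnot⟩ := hM
  rw [← not_and] at hnot
  refine ⟨S, a, b, c, d, hO, ?_, hnot⟩
  obtain ⟨hab, hbc, hcd, ha, hb, hc, hd⟩ := id hO
  suffices hsides : (M.IsBase ↑(S ∪ {a, b}) ∧ M.IsBase ↑(S ∪ {c, d})) ∧
      M.IsBase ↑(S ∪ {a, d}) ∧ M.IsBase ↑(S ∪ {b, c}) by
    rintro _ ⟨x, hx, y, hy, rfl⟩
    rw [mem_coe, mem_insert, mem_singleton] at hx hy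
    obtain rfl | rfl := hx <;> obtain rfl | rfl := hy <;> simp_all only [pair_comm]
  obtain hsides | hsides := hor
  · have := isBase_union_pair_exchange hsides.1 hsides.2 (by grind) (by grind) hd
    grind [pair_comm]
  · have := isBase_union_pair_exchange hsides.1 hsides.2 (by grind) (by grind) hc
    grind [pair_comm]

theorem exists_isTwoFace_square (hk : M.eRank = k) (hM : ¬ PosThreeTerm M) :
    ∃ S a b c d, OrderedOutside S a b c d ∧ S.card + 2 = k ∧
      IsTwoFace (matroidPolytope M) (convexHull ℝ (indVec '' squareBases S {a, c} {b, d})) := by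
  obtain ⟨S, a, b, c, d, hO, hsides, hdiag⟩ := exists_square_of_not_posThreeTerm hM
  have hS : S.card + 2 = k := by
    rw [← card_union_pair hO.lt_ab.ne hO.a_notMem hO.b_notMem]
    exact card_eq_of_isBase hk (hsides _ ⟨a, by simp, b, by simp, rfl⟩)
  refine ⟨S, a, b, c, d, hO, hS, ?_⟩
  rw [← hS] at hk
  by_cases hac : M.IsBase ↑(S ∪ {a, c})
  · rw [← squareBases_swap] at hsides ⊢
    exact hO.isSquare.symm.isTwoFace hk hsides fun hbd => hdiag ⟨hac, hbd⟩
  · exact hO.isSquare.isTwoFace hk hsides hac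

theorem OrderedOutside.not_isPositroidPolytope (hO : OrderedOutside S a b c d) :
    ¬ IsPositroidPolytope (convexHull ℝ (indVec '' squareBases S {a, c} {b, d})) := by
  rintro ⟨N, hN, hF⟩
  have hvert := congrArg (Set.extremePoints ℝ) hF
  rw [matroidPolytope, extremePoints_convexHull_indVec, extremePoints_convexHull_indVec] at hvert
  have hbase (B) : B ∈ squareBases S {a, c} {b, d} ↔ N.IsBase B :=
    Set.ext_iff.mp (indVec_injective.image_injective hvert) B
  have hside {x y} (hx : x ∈ ({a, c} : Finset (Fin n))) (hy : y ∈ ({b, d} : Finset (Fin n))) :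
      N.IsBase ↑(S ∪ {x, y}) := (hbase _).mp ⟨x, hx, y, hy, rfl⟩
  have hdiag := (hN.posThreeTerm hO (.inl ⟨hside (by simp) (by simp), hside (by simp) (by simp)⟩)).1
  obtain ⟨x, -, y, hy, h⟩ := (hbase _).mpr hdiag
  obtain hyS | hyT := mem_union.mp (coe_inj.mp h ▸ by simp : y ∈ S ∪ {a, c})
  · exact disjoint_left.mp hO.isSquare.right_disjoint hyS hy
  · exact disjoint_left.mp hO.isSquare.disjoint hyT hy

end Square
end PositroidChar

open PositroidChar in
theorem theorem3p9 (n k : ℕ) (M : Matroid (Fin n)) (hE : M.E = Set.univ)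
    (hk : M.eRank = (k : ℕ∞)) :
    (IsPositroidPolytope (matroidPolytope M) ↔ IsPositroid M) ∧
    (IsPositroidPolytope (matroidPolytope M) ↔
      ∀ F : Set (Fin n → ℝ), IsTwoFace (matroidPolytope M) F → IsPositroidPolytope F) ∧
    (¬ IsPositroid M →
      ∃ (a b c d : Fin n) (S : Finset (Fin n)) (F : Set (Fin n → ℝ)),
        a < b ∧ b < c ∧ c < d ∧
        a ∉ S ∧ b ∉ S ∧ c ∉ S ∧ d ∉ S ∧
        S.card + 2 = k ∧
        IsTwoFace (matroidPolytope M) F ∧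
        F.extremePoints ℝ =
          {indVec (↑S ∪ {a, b}), indVec (↑S ∪ {a, d}),
            indVec (↑S ∪ {b, c}), indVec (↑S ∪ {c, d})}) := by
  have hpoly : IsPositroidPolytope (matroidPolytope M) ↔ IsPositroid M :=
    ⟨fun ⟨_, hN, h⟩ => eq_of_matroidPolytope_eq hE hN.1 h ▸ hN, fun h => ⟨M, h, rfl⟩⟩
  have hsquare (h : ¬ IsPositroid M) :=
    exists_isTwoFace_square hk fun hM => h (hM.isPositroid hE)
  refine ⟨hpoly, ⟨fun h F hF => ?_, fun h => ?_⟩, fun h => ?_⟩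
  · exact (hpoly.mp h).isPositroidPolytope_of_isExposed hF.1 hF.2.1
  · by_contra hM
    obtain ⟨S, a, b, c, d, hO, -, hF⟩ := hsquare (mt hpoly.mpr hM)
    exact hO.not_isPositroidPolytope (h _ hF)
  · obtain ⟨S, a, b, c, d, hO, hS, hF⟩ := hsquare h
    exact ⟨a, b, c, d, S, _, hO.lt_ab, hO.lt_bc, hO.lt_cd, hO.a_notMem, hO.b_notMem, hO.c_notMem,
      hO.d_notMem, hS, hF, by rw [extremePoints_convexHull_indVec, image_indVec_squareBases]⟩
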